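/- There is an absolute constant $C>0$ with the following property. Let $a$ be a symmetric, unit variance real random variable that is sub-gaussian, i.e. $\kappa:=\sup_{q\ge 1}q^{-1/2}(\mathbb E|a|^q)^{1/q}<\infty$, and suppose that $\|a-g\|_{TV}:=\sup_A|\mathbb P(a\in A)-\mathbb P(g\in A)|\le\varepsilon$, where $g\sim N(0,1)$ and $A$ ranges over the Borel subsets of $\mathbb R$. Let $m\ge 1$ and let $\mathbf a_1,\dots,\mathbf a_m$ be independent random vectors in $\mathbb R^n$ whose coordinates are i.i.d. copies of $a$. Let $K\subseteq\mathbb R^n$ be contained in the Euclidean unit ball, with Gaussian mean width $w(K)=\mathbb E\sup_{\mathbf z\in K-K}\langle\mathbf g,\mathbf z\rangle$ ($\mathbf g$ a standard Gaussian vector in $\mathbb R^n$), and fix $\mathbf x\in K$ with $\|\mathbf x\|_2=1$. Let $0\le p<1/2$, and let the one-bit measurements be $y_i=\varepsilon_i\,\mathrm{sign}(\langle\mathbf a_i,\mathbf x\rangle)$, $i=1,\dots,m$, where $\mathrm{sign}(t)=1$ for $t\ge 0$ and $-1$ otherwise, and the $\varepsilon_i$ are i.i.d., independent of the $\mathbf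 a_i$, with $\mathbb P(\varepsilon_i=1)=1-p$ and $\mathbb P(\varepsilon_i=-1)=p$. Then for each $\beta>0$, with probability at least $1-4e^{-\beta^2}$, every solution $\widehat{\mathbf x}$ of the optimization problem $$\max\ \sum_{i=1}^m y_i\langle\mathbf a_i,\mathbf x'\rangle\quad\text{subject to }\mathbf x'\in K$$ satisfies $$\|\mathbf x-\widehat{\mathbf x}\|_2^2\le C\sqrt{\kappa}\,\varepsilon^{1/8}+\frac{C\kappa}{(1-2p)\sqrt m}\,(w(K)+\beta).$$ -/

import Mathlib

open MeasureTheory ProbabilityTheory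
open scoped Pointwise ENNReal

noncomputable section

namespace OneBitCS

/-- The sign function with the convention `sgn 0 = 1`. -/
def sgn (t : ℝ) : ℝ := if 0 ≤ t then 1 else -1

/-- The sub-gaussian norm `sup_{q ≥ 1} q^{-1/2} (E |X|^q)^{1/q}` of a random variable,
with values in `[0, ∞]`. -/
def subgaussianNorm {Ω : Type*} [MeasurableSpace Ω] (X : Ω → ℝ) (P : Measure Ω) : ℝ≥0∞ :=
  ⨆ (q : ℝ) (_ : 1 ≤ q), ENNReal.ofReal (q ^ (-(1 / 2) : ℝ)) * eLpNorm X (ENNReal.ofReal q) P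

/-- The total variation distance `sup_A |μ(A) - ν(A)|`, over the measurable sets `A`, of two
probability measures on a measurable space. -/
def tvDist {α : Type*} [MeasurableSpace α] (μ ν : Measure α) : ℝ :=
  ⨆ A : {A : Set α // MeasurableSet A}, |μ.real A - ν.real A|

/-- The Gaussian mean width `E sup_{z ∈ K - K} ⟨g, z⟩` of a set `K`, where `g` is a standard
Gaussian random vector. -/
def meanWidth {n : ℕ} (K : Set (EuclideanSpace ℝ (Fin n))) : ℝ :=
  ∫ g, (⨆ z : ↥(K - K), inner ℝ g (z : EuclideanSpace ℝ (Fin n)))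
    ∂(stdGaussian (EuclideanSpace ℝ (Fin n)))

/-- The one-bit measurements `y_i = e_i * sgn ⟨a_i, x⟩` with flips `e_i`. -/
def measurements {m n : ℕ} (a : Fin m → EuclideanSpace ℝ (Fin n)) (e : Fin m → ℝ)
    (x : EuclideanSpace ℝ (Fin n)) : Fin m → ℝ :=
  fun i => e i * sgn (inner ℝ (a i) x)

/-- `x'` solves the program: maximize `∑ i, y_i ⟨a_i, x'⟩` subject to `x' ∈ K`. -/
def IsSolution {m n : ℕ} (a : Fin m → EuclideanSpace ℝ (Fin n)) (y : Fin m → ℝ)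
    (K : Set (EuclideanSpace ℝ (Fin n))) (x' : EuclideanSpace ℝ (Fin n)) : Prop :=
  x' ∈ K ∧ IsMaxOn (fun u => ∑ i, y i * inner ℝ (a i) u) K x'

end OneBitCS

end

/-! Put z = x' - x, Y_i = y_i a_i and V = ∑ (Y_i - E Y_i). Optimality gives ∑ ⟨Y_i, z⟩ ≥ 0, so -∑ ⟨E
Y_i, z⟩ ≤ ⟨V, z⟩ ≤ sup_{u ∈ K - K} ⟨V, u⟩. The error bound follows once the left side is at least of
order m(1-2p)‖z‖², up to a bias, and the right side is small with high probability
(`sq_norm_sub_le_of_isSolution`).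

Mean: ⟨E Y_i, z⟩ = (1-2p) E sgn⟨a,x⟩⟨a,z⟩, and the sign is a subgradient of the absolute value, so
this expectation is controlled by the function y ↦ E|⟨a,y⟩|. For Gaussian a the latter is exactly
L‖y‖. Closeness in total variation, with bounded fourth moments, yields a coupling with E(a-g)² of
order κ²√ε. Differences of independent coordinates are orthogonal, so E|⟨a,y⟩| is within δ‖y‖ of
L‖y‖, where δ is of order κ ε^(1/4), in every dimension (`abs_integral_abs_inner_sub_le`). A
first-order expansion at x with step √δ costs an error √δ, whence √κ ε^(1/8)
(`integral_sgn_mul_inner_le`).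

Deviation: V is compared with a Gaussian vector in the convex order. A symmetric sub-gaussian
variable is dominated by a multiple of κ g; domination passes to vectors with independent
coordinates, survives signs and centring at the cost of a factor 2, and passes to independent sums,
where m terms cost √m. The exponential of a support function is convex, so its moments for V are
bounded by the Gaussian ones (`lintegral_exp_supportFn_le`), and Markov's inequality finishes
(`measure_lt_supportFn_le`). No chaining or comparison of processes is needed. -/

namespace OneBitCS

/-! ### Convex order: stability under linear maps, independent sums, signs and centring. -/

section ConvexDomination

variable {E : Type*} [NormedAddCommGroup E] [NormedSpace ℝ E] [MeasurableSpace E] [BorelSpace E]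

/-- `μ` is dominated by `ν` in the convex order, tested against nonnegative continuous convex
functions. -/
def ConvexDominated (μ ν : Measure E) : Prop :=
  ∀ φ : E → ℝ, ConvexOn ℝ Set.univ φ → Continuous φ → (∀ x, 0 ≤ φ x) →
    ∫⁻ x, ENNReal.ofReal (φ x) ∂μ ≤ ∫⁻ x, ENNReal.ofReal (φ x) ∂ν

namespace ConvexDominated

omit [BorelSpace E] in
lemma trans {μ ν ρ : Measure E} (h₁ : ConvexDominated μ ν) (h₂ : ConvexDominated ν ρ) :
    ConvexDominated μ ρ := fun φ hc hk h0 => (h₁ φ hc hk h0).trans (h₂ φ hc hk h0)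

lemma map {F : Type*} [NormedAddCommGroup F] [NormedSpace ℝ F] [MeasurableSpace F] [BorelSpace F]
    {μ ν : Measure E} (h : ConvexDominated μ ν) (f : E →L[ℝ] F) :
    ConvexDominated (μ.map f) (ν.map f) := by
  intro φ hc hk h0
  have hm : Measurable fun x => ENNReal.ofReal (φ x) := hk.measurable.ennreal_ofReal
  rw [lintegral_map hm f.continuous.measurable, lintegral_map hm f.continuous.measurable]
  exact h (fun x => φ (f x)) (hc.comp_linearMap f.toLinearMap) (hk.comp f.continuous)
    fun x => h0 _

/-- A translate of a convex function is convex, so the two summands can be exchanged one at a time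
by Tonelli. -/
lemma lintegral_prod_add [SecondCountableTopology E] {μ μ' ν ν' : Measure E} [SFinite μ]
    [SFinite μ'] [SFinite ν] [SFinite ν'] (h : ConvexDominated μ ν) (h' : ConvexDominated μ' ν')
    {φ : E → ℝ} (hc : ConvexOn ℝ Set.univ φ) (hk : Continuous φ) (h0 : ∀ x, 0 ≤ φ x) :
    ∫⁻ z, ENNReal.ofReal (φ (z.1 + z.2)) ∂(μ.prod μ')
      ≤ ∫⁻ z, ENNReal.ofReal (φ (z.1 + z.2)) ∂(ν.prod ν') := by
  have hm : Measurable fun z : E × E => ENNReal.ofReal (φ (z.1 + z.2)) :=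
    (hk.comp (continuous_fst.add continuous_snd)).measurable.ennreal_ofReal
  have hr : ∀ y : E, ConvexOn ℝ Set.univ fun x => φ (x + y) := fun y => by
    simpa [Function.comp_def] using hc.translate_left y
  have hl : ∀ y : E, ConvexOn ℝ Set.univ fun x => φ (y + x) := fun y => by
    simpa [Function.comp_def] using hc.translate_right y
  calc ∫⁻ z, ENNReal.ofReal (φ (z.1 + z.2)) ∂(μ.prod μ')
      = ∫⁻ x, ∫⁻ y, ENNReal.ofReal (φ (x + y)) ∂μ' ∂μ := lintegral_prod _ hm.aemeasurable
    _ ≤ ∫⁻ x, ∫⁻ y, ENNReal.ofReal (φ (x + y)) ∂ν' ∂μ :=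
        lintegral_mono fun x => h' _ (hl x) (by fun_prop) fun _ => h0 _
    _ = ∫⁻ y, ∫⁻ x, ENNReal.ofReal (φ (x + y)) ∂μ ∂ν' :=
        lintegral_lintegral_swap hm.aemeasurable
    _ ≤ ∫⁻ y, ∫⁻ x, ENNReal.ofReal (φ (x + y)) ∂ν ∂ν' :=
        lintegral_mono fun y => h _ (hr y) (by fun_prop) fun _ => h0 _
    _ = ∫⁻ z, ENNReal.ofReal (φ (z.1 + z.2)) ∂(ν.prod ν') := by
        rw [lintegral_prod_symm _ hm.aemeasurable]

variable {Ω Ω' : Type*} [MeasurableSpace Ω] [MeasurableSpace Ω'] {P : Measure Ω} {P' : Measure Ω'}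
  [IsProbabilityMeasure P] [IsProbabilityMeasure P']

lemma map_add [SecondCountableTopology E] {X Y : Ω → E} {X' Y' : Ω' → E} (hX : Measurable X)
    (hY : Measurable Y) (hX' : Measurable X') (hY' : Measurable Y') (hi : IndepFun X Y P)
    (hi' : IndepFun X' Y' P') (h : ConvexDominated (P.map X) (P'.map X'))
    (h' : ConvexDominated (P.map Y) (P'.map Y')) :
    ConvexDominated (P.map (X + Y)) (P'.map (X' + Y')) := by
  intro φ hc hk h0
  have hm : Measurable fun x => ENNReal.ofReal (φ x) := hk.measurable.ennreal_ofReal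
  have hm2 : Measurable fun z : E × E => ENNReal.ofReal (φ (z.1 + z.2)) :=
    (hk.comp (continuous_fst.add continuous_snd)).measurable.ennreal_ofReal
  have key := h.lintegral_prod_add h' hc hk h0
  rw [← (indepFun_iff_map_prod_eq_prod_map_map hX.aemeasurable hY.aemeasurable).1 hi,
    ← (indepFun_iff_map_prod_eq_prod_map_map hX'.aemeasurable hY'.aemeasurable).1 hi',
    lintegral_map hm2 (by fun_prop), lintegral_map hm2 (by fun_prop)] at key
  rw [lintegral_map hm (by fun_prop), lintegral_map hm (by fun_prop)]
  exact key

/-- Convex domination is stable under sums of independent random vectors. -/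
lemma map_sum [SecondCountableTopology E] {ι : Type*} {X : ι → Ω → E} {Y : ι → Ω' → E}
    (hX : ∀ i, Measurable (X i)) (hY : ∀ i, Measurable (Y i)) (hiX : iIndepFun X P)
    (hiY : iIndepFun Y P') (h : ∀ i, ConvexDominated (P.map (X i)) (P'.map (Y i)))
    (s : Finset ι) : ConvexDominated (P.map (∑ i ∈ s, X i)) (P'.map (∑ i ∈ s, Y i)) := by
  classical
  induction s using Finset.induction_on with
  | empty =>
    intro φ _ hk _
    have hm : Measurable fun x => ENNReal.ofReal (φ x) := hk.measurable.ennreal_ofReal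
    simp only [Finset.sum_empty]
    rw [lintegral_map hm measurable_zero, lintegral_map hm measurable_zero]
    simp
  | insert i s hi ih =>
    rw [Finset.sum_insert hi, Finset.sum_insert hi]
    have hXs : Measurable (∑ j ∈ s, X j) := by
      rw [Finset.sum_fn]
      exact Finset.measurable_sum _ fun j _ => hX j
    have hYs : Measurable (∑ j ∈ s, Y j) := by
      rw [Finset.sum_fn]
      exact Finset.measurable_sum _ fun j _ => hY j
    exact map_add (hX i) hXs (hY i) hYs
      (hiX.indepFun_finsetSum_of_notMem hX hi).symm (hiY.indepFun_finsetSum_of_notMem hY hi).symm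
      (h i) ih

omit [MeasurableSpace E] [BorelSpace E] in
/-- Jensen's inequality for nonnegative convex functions, without integrability of the
composition. -/
lemma _root_.ConvexOn.ofReal_map_integral_le [CompleteSpace E] {φ : E → ℝ}
    (hc : ConvexOn ℝ Set.univ φ) (hk : Continuous φ) (h0 : ∀ x, 0 ≤ φ x) {X : Ω → E}
    (hX : Integrable X P) :
    ENNReal.ofReal (φ (∫ ω, X ω ∂P)) ≤ ∫⁻ ω, ENNReal.ofReal (φ (X ω)) ∂P := by
  by_cases hi : Integrable (fun ω => φ (X ω)) P
  · have h1 := hc.map_integral_le (μ := P) hk.continuousOn isClosed_univ (by simp) hX hi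
    rw [← ofReal_integral_eq_lintegral_ofReal hi (Filter.Eventually.of_forall fun ω => h0 _)]
    exact ENNReal.ofReal_le_ofReal h1
  · have : ∫⁻ ω, ENNReal.ofReal (φ (X ω)) ∂P = ∞ := by
      by_contra hne
      refine hi ⟨hk.comp_aestronglyMeasurable hX.aestronglyMeasurable, ?_⟩
      rw [hasFiniteIntegral_iff_ofReal (Filter.Eventually.of_forall fun ω => h0 _)]
      exact lt_of_le_of_ne le_top hne
    rw [this]
    exact le_top

/-- Centring and multiplying a symmetric random vector by signs costs a factor `2` in the convex
order. -/
lemma map_sub_integral [SecondCountableTopology E] [CompleteSpace E] {X Y : Ω → E}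
    (hX : Measurable X) (hY : Measurable Y)
    (hYi : Integrable Y P) (hs : ∀ᵐ ω ∂P, Y ω = X ω ∨ Y ω = -X ω)
    (hsym : (P.map X).map (fun x => -x) = P.map X) :
    ConvexDominated (P.map fun ω => Y ω - ∫ ω', Y ω' ∂P) (P.map fun ω => (2 : ℝ) • X ω) := by
  intro φ hc hk h0
  have hm : Measurable fun x => ENNReal.ofReal (φ x) := hk.measurable.ennreal_ofReal
  rw [lintegral_map hm (by fun_prop), lintegral_map hm (by fun_prop)]
  set e := ∫ ω', Y ω' ∂P with he
  have hneg : ∫⁻ ω, ENNReal.ofReal (φ ((-2 : ℝ) • X ω)) ∂P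
      = ∫⁻ ω, ENNReal.ofReal (φ ((2 : ℝ) • X ω)) ∂P := by
    have hm' : Measurable fun x : E => ENNReal.ofReal (φ ((2 : ℝ) • x)) := by fun_prop
    rw [← lintegral_map (f := fun x => ENNReal.ofReal (φ ((2 : ℝ) • x))) hm' hX]
    conv_rhs => rw [← hsym]
    rw [lintegral_map hm' (by fun_prop), lintegral_map (by fun_prop) hX]
    simp
  -- Write Y - e as the midpoint of 2Y and -2e; Jensen then replaces the mean e by Y itself.
  have hJ : ENNReal.ofReal (φ ((-2 : ℝ) • e)) ≤ ∫⁻ ω, ENNReal.ofReal (φ ((-2 : ℝ) • Y ω)) ∂P := by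
    have := hc.ofReal_map_integral_le (P := P) hk h0 (hYi.smul (-2 : ℝ))
    rwa [show (∫ ω, ((-2 : ℝ) • Y) ω ∂P) = (-2 : ℝ) • e by
      simp only [Pi.smul_apply]; rw [integral_smul]] at this
  have hmid : ∀ ω, ENNReal.ofReal (φ (Y ω - e))
      ≤ ENNReal.ofReal (1 / 2) * (ENNReal.ofReal (φ ((2 : ℝ) • Y ω))
        + ENNReal.ofReal (φ ((-2 : ℝ) • e))) := fun ω => by
    rw [← ENNReal.ofReal_add (h0 _) (h0 _), ← ENNReal.ofReal_mul (by norm_num)]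
    refine ENNReal.ofReal_le_ofReal ?_
    have := hc.2 (Set.mem_univ ((2 : ℝ) • Y ω)) (Set.mem_univ ((-2 : ℝ) • e))
      (by norm_num : (0 : ℝ) ≤ 1 / 2) (by norm_num : (0 : ℝ) ≤ 1 / 2) (by norm_num)
    rw [smul_smul, smul_smul] at this
    norm_num at this
    rw [sub_eq_add_neg, neg_smul]
    linarith
  -- φ(2y) + φ(-2y) is even in y, so it does not see the sign relating Y to X. The sign may
  -- therefore depend on X.
  have hYX : ∫⁻ ω, ENNReal.ofReal (φ ((2 : ℝ) • Y ω)) ∂P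
      + ∫⁻ ω, ENNReal.ofReal (φ ((-2 : ℝ) • Y ω)) ∂P
      = ∫⁻ ω, ENNReal.ofReal (φ ((2 : ℝ) • X ω)) ∂P
      + ∫⁻ ω, ENNReal.ofReal (φ ((-2 : ℝ) • X ω)) ∂P := by
    rw [← lintegral_add_left (by fun_prop), ← lintegral_add_left (by fun_prop)]
    refine lintegral_congr_ae ?_
    filter_upwards [hs] with ω h
    rcases h with h | h
    · simp only [h]
    · simp only [h, smul_neg, neg_smul, neg_neg]
      rw [add_comm]
  calc ∫⁻ ω, ENNReal.ofReal (φ (Y ω - e)) ∂P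
      ≤ ∫⁻ ω, ENNReal.ofReal (1 / 2) * (ENNReal.ofReal (φ ((2 : ℝ) • Y ω))
        + ENNReal.ofReal (φ ((-2 : ℝ) • e))) ∂P := lintegral_mono hmid
    _ = ENNReal.ofReal (1 / 2) * (∫⁻ ω, ENNReal.ofReal (φ ((2 : ℝ) • Y ω)) ∂P
        + ENNReal.ofReal (φ ((-2 : ℝ) • e))) := by
        rw [lintegral_const_mul _ (by fun_prop), lintegral_add_right _ (by fun_prop)]
        simp
    _ ≤ ENNReal.ofReal (1 / 2) * (∫⁻ ω, ENNReal.ofReal (φ ((2 : ℝ) • Y ω)) ∂P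
        + ∫⁻ ω, ENNReal.ofReal (φ ((-2 : ℝ) • Y ω)) ∂P) := by gcongr
    _ = ENNReal.ofReal (1 / 2) * (2 * ∫⁻ ω, ENNReal.ofReal (φ ((2 : ℝ) • X ω)) ∂P) := by
        rw [hYX, hneg, two_mul]
    _ = ∫⁻ ω, ENNReal.ofReal (φ ((2 : ℝ) • X ω)) ∂P := by
        rw [← mul_assoc, show (2 : ℝ≥0∞) = ENNReal.ofReal 2 by simp,
          ← ENNReal.ofReal_mul (by norm_num)]
        norm_num

end ConvexDominated

/-- An up-set of `[0, ∞)` cut out by a continuous even function that is monotone on `[0, ∞)`. -/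
lemma setOf_lt_eq_of_monotone_abs {e : ℝ → ℝ} (hk : Continuous e) (h0 : e 0 = 0)
    (habs : ∀ x y, |x| ≤ |y| → e x ≤ e y) {s : ℝ} (hs : 0 < s) :
    {x | s < e x} = ∅ ∨ ∃ t, 0 ≤ t ∧ {x | s < e x} = {x | t < |x|} := by
  by_cases hne : ∃ x, s < e x
  swap
  · left
    ext x
    simpa using not_exists.1 hne x
  right
  have hee : ∀ x, e x = e |x| := fun x =>
    le_antisymm (habs _ _ (by simp)) (habs _ _ (by simp))
  obtain ⟨x₀, hx₀⟩ := hne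
  rw [hee] at hx₀
  obtain ⟨t, ht, hts⟩ : ∃ t ∈ Set.Icc 0 |x₀|, e t = s :=
    intermediate_value_Icc (abs_nonneg _) hk.continuousOn ⟨by rw [h0]; exact hs.le, hx₀.le⟩
  have hcl : IsCompact (Set.Icc 0 |x₀| ∩ e ⁻¹' {s}) :=
    isCompact_Icc.inter_right (isClosed_singleton.preimage hk)
  -- The largest point of the level set is taken, so that e exceeds s strictly beyond it.
  obtain ⟨T, hT, hmax⟩ := hcl.exists_isMaxOn ⟨t, ht, hts⟩ continuousOn_id
  refine ⟨T, hT.1.1, ?_⟩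
  ext x
  simp only [Set.mem_ofPred_eq]
  constructor
  · intro hx
    by_contra hle
    have := habs x T (by rw [abs_of_nonneg hT.1.1]; exact not_lt.1 hle)
    rw [show e T = s from hT.2] at this
    linarith
  · intro hx
    by_contra hle
    have hxs : e |x| = s := by
      refine le_antisymm (by rw [← hee]; exact not_lt.1 hle) ?_
      rw [← show e T = s from hT.2]
      exact habs _ _ (by rw [abs_of_nonneg hT.1.1, abs_abs]; exact hx.le)
    have hxx : |x| ≤ |x₀| := by
      by_contra hlt
      have := habs x₀ x (not_le.1 hlt).le
      rw [hee x₀, hee x] at this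
      linarith
    exact absurd (hmax ⟨⟨abs_nonneg _, hxx⟩, hxs⟩) (not_le.2 hx)

/-- A symmetric law only sees the even part φ(0) + e of φ. Both sides live in [0, ∞], so no
integrability is needed. -/
lemma lintegral_ofReal_eq_of_symm {μ : Measure ℝ} [IsProbabilityMeasure μ]
    (hμ : μ.map (fun x => -x) = μ) {φ : ℝ → ℝ} (hk : Continuous φ) (h0 : ∀ x, 0 ≤ φ x)
    {e : ℝ → ℝ} (hek : Continuous e) (he0 : ∀ x, 0 ≤ e x)
    (he : ∀ x, φ x + φ (-x) = 2 * (φ 0 + e x)) :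
    ∫⁻ x, ENNReal.ofReal (φ x) ∂μ = ENNReal.ofReal (φ 0) + ∫⁻ x, ENNReal.ofReal (e x) ∂μ := by
  have hneg : ∫⁻ x, ENNReal.ofReal (φ (-x)) ∂μ = ∫⁻ x, ENNReal.ofReal (φ x) ∂μ := by
    conv_rhs => rw [← hμ]
    rw [lintegral_map (by fun_prop) (by fun_prop)]
  have h2 : 2 * ∫⁻ x, ENNReal.ofReal (φ x) ∂μ
      = 2 * (ENNReal.ofReal (φ 0) + ∫⁻ x, ENNReal.ofReal (e x) ∂μ) := by
    calc 2 * ∫⁻ x, ENNReal.ofReal (φ x) ∂μ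
        = ∫⁻ x, (ENNReal.ofReal (φ x) + ENNReal.ofReal (φ (-x))) ∂μ := by
          rw [lintegral_add_left (by fun_prop), hneg, two_mul]
      _ = ∫⁻ x, 2 * (ENNReal.ofReal (φ 0) + ENNReal.ofReal (e x)) ∂μ := by
          refine lintegral_congr fun x => ?_
          rw [← ENNReal.ofReal_add (h0 _) (h0 _), he, ENNReal.ofReal_mul (by norm_num),
            ENNReal.ofReal_add (h0 _) (he0 _)]
          simp
      _ = _ := by
          rw [lintegral_const_mul _ (by fun_prop), lintegral_add_left (by fun_prop)]
          simp
  exact (ENNReal.mul_right_inj two_ne_zero ENNReal.ofNat_ne_top).1 h2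

/-- A symmetric distribution on the line is dominated in the convex order by a dilation of any
symmetric distribution that dominates its tails up to a constant factor. -/
lemma ConvexDominated.of_tail {μ ν : Measure ℝ} [IsProbabilityMeasure μ] [IsProbabilityMeasure ν]
    (hμ : μ.map (fun x => -x) = μ) (hν : ν.map (fun x => -x) = ν) {N : ℝ} (hN : 1 ≤ N)
    (h : ∀ t, 0 ≤ t → μ {x | t < |x|} ≤ ENNReal.ofReal N * ν {x | t < |x|}) :
    ConvexDominated μ (ν.map fun x => N * x) := by
  intro φ hc hk h0
  have hN0 : 0 < N := by linarith
  -- The even part of φ, normalised to vanish at 0. Being convex and even, it is monotone in |x|, so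
  -- its superlevel sets are exactly the tail events of the hypothesis.
  set e : ℝ → ℝ := fun x => (φ x + φ (-x)) / 2 - φ 0 with he_def
  have hek : Continuous e := by fun_prop
  have hec : ConvexOn ℝ Set.univ e := by
    have hcn : ConvexOn ℝ Set.univ fun x => φ (-x) := hc.comp_linearMap (-LinearMap.id)
    have := ((hc.add hcn).smul (by norm_num : (0 : ℝ) ≤ 1 / 2)).add
      (convexOn_const (-φ 0) convex_univ)
    refine this.congr fun x _ => ?_
    simp [he_def]
    ring
  have he00 : e 0 = 0 := by simp [he_def]
  have hneg : ∀ x, e (-x) = e x := fun x => by simp [he_def, add_comm]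
  have he0 : ∀ x, 0 ≤ e x := fun x => by
    have := hec.2 (Set.mem_univ x) (Set.mem_univ (-x)) (by norm_num : (0 : ℝ) ≤ 1 / 2)
      (by norm_num : (0 : ℝ) ≤ 1 / 2) (by norm_num)
    rw [hneg] at this
    simp only [smul_eq_mul] at this
    rw [show 1 / 2 * x + 1 / 2 * -x = 0 by ring, he00] at this
    linarith
  have hscale : ∀ x θ : ℝ, 0 ≤ θ → θ ≤ 1 → e (θ * x) ≤ θ * e x := fun x θ h1 h2 => by
    have := hec.2 (Set.mem_univ x) (Set.mem_univ 0) h1 (by linarith : 0 ≤ 1 - θ) (by ring)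
    simpa [he00] using this
  have heabs : ∀ x, e |x| = e x := fun x => by
    rcases abs_choice x with h | h <;> rw [h]
    exact hneg x
  have habs : ∀ x y, |x| ≤ |y| → e x ≤ e y := fun x y hxy => by
    rcases eq_or_lt_of_le (abs_nonneg y) with hy | hy
    · have : x = 0 := abs_eq_zero.1 (le_antisymm (hxy.trans hy.symm.le) (abs_nonneg _))
      rw [this, he00]
      exact he0 y
    · have := hscale |y| (|x| / |y|) (by positivity) ((div_le_one hy).2 hxy)
      rw [div_mul_cancel₀ _ hy.ne', heabs, heabs] at this
      refine this.trans (mul_le_of_le_one_left (he0 y) ((div_le_one hy).2 hxy))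
  have hφe : ∀ x, φ x + φ (-x) = 2 * (φ 0 + e x) := fun x => by simp [he_def]; ring
  have hm : Measurable fun x => ENNReal.ofReal (φ x) := hk.measurable.ennreal_ofReal
  have hprob : IsProbabilityMeasure (ν.map fun x => N * x) :=
    Measure.isProbabilityMeasure_map (by fun_prop)
  have hνN : (ν.map fun x => N * x).map (fun x => -x) = ν.map fun x => N * x := by
    conv_rhs => rw [← hν]
    rw [Measure.map_map (by fun_prop) (by fun_prop), Measure.map_map (by fun_prop) (by fun_prop)]
    congr 1
    ext x
    simp
  rw [lintegral_ofReal_eq_of_symm hμ hk h0 hek he0 hφe,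
    lintegral_ofReal_eq_of_symm hνN hk h0 hek he0 hφe, lintegral_map (by fun_prop) (by fun_prop)]
  refine add_le_add le_rfl ?_
  calc ∫⁻ x, ENNReal.ofReal (e x) ∂μ
      = ∫⁻ s in Set.Ioi (0 : ℝ), μ {x | s < e x} :=
        lintegral_eq_lintegral_meas_lt _ (Filter.Eventually.of_forall he0) hek.aemeasurable
    _ ≤ ∫⁻ s in Set.Ioi (0 : ℝ), ENNReal.ofReal N * ν {x | s < e x} := by
        refine setLIntegral_mono' measurableSet_Ioi fun s hs => ?_
        rcases setOf_lt_eq_of_monotone_abs hek he00 habs hs with h' | ⟨t, ht, h'⟩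
        · simp [h']
        · rw [h']
          exact h t ht
    _ = ENNReal.ofReal N * ∫⁻ x, ENNReal.ofReal (e x) ∂ν := by
        rw [lintegral_const_mul' _ _ ENNReal.ofReal_ne_top,
          lintegral_eq_lintegral_meas_lt _ (Filter.Eventually.of_forall he0) hek.aemeasurable]
    _ = ∫⁻ x, ENNReal.ofReal (N * e x) ∂ν := by
        rw [← lintegral_const_mul' _ _ ENNReal.ofReal_ne_top]
        exact lintegral_congr fun x => (ENNReal.ofReal_mul hN0.le).symm
    _ ≤ ∫⁻ x, ENNReal.ofReal (e (N * x)) ∂ν := by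
        -- Convexity and e(0) = 0 give N e(x) ≤ e(Nx): a constant factor in the tails is absorbed by
        -- a dilation.
        refine lintegral_mono fun x => ENNReal.ofReal_le_ofReal ?_
        have := hscale (N * x) (1 / N) (by positivity) ((div_le_one hN0).2 hN)
        rw [← mul_assoc, one_div_mul_cancel hN0.ne', one_mul, one_div, inv_mul_eq_div,
          le_div_iff₀ hN0] at this
        linarith

end ConvexDomination

/-! ### Gaussian domination of sub-gaussian variables, vectors and sums. -/

section GaussianDomination

/-- Exponential tail bound for a variable whose moments grow like those of a Gaussian. -/
lemma measure_lt_abs_le_exp {Ω : Type*} [MeasurableSpace Ω] {P : Measure Ω}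
    [IsProbabilityMeasure P] {X : Ω → ℝ} (hX : Measurable X) {κ : ℝ} (hκ : 0 < κ)
    (h : ∀ q : ℝ, 1 ≤ q → eLpNorm X (ENNReal.ofReal q) P ≤ ENNReal.ofReal (κ * √q))
    {t : ℝ} (ht : 0 ≤ t) :
    P {ω | t < |X ω|} ≤ ENNReal.ofReal (Real.exp (1 - (t / (Real.exp 1 * κ)) ^ 2)) := by
  set s := t / (Real.exp 1 * κ) with hs
  have hs0 : 0 ≤ s := by positivity
  have hts : t = Real.exp 1 * κ * s := by rw [hs]; field_simp
  rcases lt_or_ge s 1 with h1 | h1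
  · refine prob_le_one.trans ?_
    rw [← ENNReal.ofReal_one]
    exact ENNReal.ofReal_le_ofReal (Real.one_le_exp (by nlinarith))
  have ht0 : 0 < t := by rw [hts]; positivity
  have hq : (1 : ℝ) ≤ s ^ 2 := by nlinarith
  have hq0 : (0 : ℝ) < s ^ 2 := by positivity
  -- Markov with exponent q = s², where s = t/(eκ), makes (κ√q / t)^q equal to exp(-s²). This needs
  -- s ≥ 1; for s < 1 the claimed bound exceeds 1.
  have hM := meas_ge_le_mul_pow_eLpNorm_enorm P (p := ENNReal.ofReal (s ^ 2))
    (ENNReal.ofReal_pos.2 hq0).ne' ENNReal.ofReal_ne_top hX.aestronglyMeasurable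
    (ε := ENNReal.ofReal t) (by simpa using ht0) (by simp)
  calc P {ω | t < |X ω|} ≤ P {ω | ENNReal.ofReal t ≤ ‖X ω‖ₑ} := by
        refine measure_mono fun ω hω => ?_
        simp only [Set.mem_ofPred_eq] at hω ⊢
        rw [Real.enorm_eq_ofReal_abs]
        exact ENNReal.ofReal_le_ofReal hω.le
    _ ≤ _ := hM
    _ ≤ ENNReal.ofReal (t⁻¹ ^ (s ^ 2)) * ENNReal.ofReal ((κ * s) ^ (s ^ 2)) := by
        rw [ENNReal.toReal_ofReal hq0.le, ← ENNReal.ofReal_inv_of_pos ht0,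
          ENNReal.ofReal_rpow_of_nonneg (by positivity) hq0.le]
        gcongr
        rw [← ENNReal.ofReal_rpow_of_nonneg (by positivity) hq0.le]
        gcongr
        have := h _ hq
        rwa [Real.sqrt_sq hs0] at this
    _ = ENNReal.ofReal (Real.exp (-s ^ 2)) := by
        rw [← ENNReal.ofReal_mul (by positivity), ← Real.mul_rpow (by positivity) (by positivity)]
        have : t⁻¹ * (κ * s) = Real.exp (-1) := by
          rw [hts, Real.exp_neg]
          have : 0 < s := by linarith
          field_simp
        rw [this, ← Real.exp_mul]
        ring_nf
    _ ≤ _ := ENNReal.ofReal_le_ofReal (Real.exp_le_exp.2 (by linarith))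

/-- On (s, s+1) one has x²/2 ≤ 1 + s², and the interval has length 1. The form matches the upper
tail bound exp(1 - s²) up to the factor e²√(2π). -/
lemma ofReal_le_gaussianReal_lt_abs (s : ℝ) :
    ENNReal.ofReal ((√(2 * Real.pi))⁻¹ * Real.exp (-1 - s ^ 2))
      ≤ gaussianReal 0 1 {x | s < |x|} := by
  calc ENNReal.ofReal ((√(2 * Real.pi))⁻¹ * Real.exp (-1 - s ^ 2))
      = ∫⁻ _ in Set.Ioo s (s + 1), ENNReal.ofReal ((√(2 * Real.pi))⁻¹ * Real.exp (-1 - s ^ 2)) := by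
        simp
    _ ≤ ∫⁻ x in Set.Ioo s (s + 1), gaussianPDF 0 1 x := by
        refine setLIntegral_mono' measurableSet_Ioo fun x hx => ?_
        rw [gaussianPDF, gaussianPDFReal]
        refine ENNReal.ofReal_le_ofReal ?_
        simp only [NNReal.coe_one, mul_one, sub_zero]
        gcongr
        nlinarith [hx.1, hx.2, sq_nonneg (s - 1)]
    _ = gaussianReal 0 1 (Set.Ioo s (s + 1)) := (gaussianReal_apply _ one_ne_zero _).symm
    _ ≤ _ := measure_mono fun x hx => by
        simp only [Set.mem_ofPred_eq]
        exact hx.1.trans_le (le_abs_self x)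

lemma gaussianReal_map_neg_zero {v : NNReal} :
    (gaussianReal 0 v).map (fun x => -x) = gaussianReal 0 v := by
  simpa using gaussianReal_map_neg (μ := 0) (v := v)

/-- The dilation factor with which a standard Gaussian dominates a symmetric variable of unit
sub-gaussian norm in the convex order. -/
noncomputable def dominationConst : ℝ := Real.exp 3 * √(2 * Real.pi)

lemma dominationConst_pos : 0 < dominationConst := by unfold dominationConst; positivity

/-- A symmetric sub-gaussian variable is dominated by a Gaussian in the convex order. -/
lemma convexDominated_gaussianReal {Ω : Type*} [MeasurableSpace Ω] {P : Measure Ω}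
    [IsProbabilityMeasure P] {X : Ω → ℝ} (hX : Measurable X)
    (hsym : (P.map X).map (fun x => -x) = P.map X) {κ : ℝ} (hκ : 0 < κ)
    (h : ∀ q : ℝ, 1 ≤ q → eLpNorm X (ENNReal.ofReal q) P ≤ ENNReal.ofReal (κ * √q)) :
    ConvexDominated (P.map X) ((gaussianReal 0 1).map fun x => dominationConst * κ * x) := by
  have hpm : IsProbabilityMeasure (P.map X) := Measure.isProbabilityMeasure_map hX.aemeasurable
  have heκ : 0 < Real.exp 1 * κ := by positivity
  set ν := (gaussianReal 0 1).map fun x => Real.exp 1 * κ * x with hν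
  have hpν : IsProbabilityMeasure ν := Measure.isProbabilityMeasure_map (by fun_prop)
  have hνsym : ν.map (fun x => -x) = ν := by
    rw [hν]
    conv_rhs => rw [← gaussianReal_map_neg_zero]
    rw [Measure.map_map (by fun_prop) (by fun_prop), Measure.map_map (by fun_prop) (by fun_prop)]
    congr 1
    ext x
    simp
  have hpi : (1 : ℝ) ≤ √(2 * Real.pi) := Real.one_le_sqrt.2 (by nlinarith [Real.pi_gt_three])
  -- e²√(2π) is the ratio of the two tail bounds; multiplied by the dilation eκ already in ν it
  -- gives `dominationConst * κ`.
  have hN : 1 ≤ Real.exp 2 * √(2 * Real.pi) :=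
    one_le_mul_of_one_le_of_one_le (Real.one_le_exp (by norm_num)) hpi
  have key := ConvexDominated.of_tail hsym hνsym hN fun t ht => ?_
  · rw [hν, Measure.map_map (by fun_prop) (by fun_prop)] at key
    convert key using 2
    ext x
    simp only [dominationConst, Function.comp_apply]
    rw [show (3 : ℝ) = 2 + 1 by norm_num, Real.exp_add]
    ring
  · have hms : MeasurableSet {x : ℝ | t < |x|} := measurableSet_lt measurable_const (by fun_prop)
    rw [Measure.map_apply hX hms, hν, Measure.map_apply (by fun_prop) hms]
    have hset : (fun x => Real.exp 1 * κ * x) ⁻¹' {x : ℝ | t < |x|}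
        = {x | t / (Real.exp 1 * κ) < |x|} := by
      ext x
      simp only [Set.mem_preimage, Set.mem_ofPred_eq, abs_mul _ x, abs_of_pos heκ]
      rw [div_lt_iff₀ heκ, mul_comm |x|]
    rw [hset]
    refine (measure_lt_abs_le_exp hX hκ h ht).trans ?_
    refine le_trans ?_ (mul_le_mul_right (ofReal_le_gaussianReal_lt_abs _) _)
    rw [← ENNReal.ofReal_mul (by positivity)]
    refine ENNReal.ofReal_le_ofReal (le_of_eq ?_)
    have : 0 < √(2 * Real.pi) := by linarith
    generalize t / (Real.exp 1 * κ) = s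
    rw [show (1 : ℝ) - s ^ 2 = 2 + (-1 - s ^ 2) by ring, Real.exp_add]
    field_simp

variable {Ω : Type*} [MeasurableSpace Ω] {P : Measure Ω} [IsProbabilityMeasure P]

/-- A random vector with independent coordinates that are dominated by a centred Gaussian is
dominated by a Gaussian vector. -/
lemma convexDominated_stdGaussian_of_coord {n : ℕ} {X : Ω → EuclideanSpace ℝ (Fin n)}
    (hX : Measurable X) (hi : iIndepFun (fun j ω => X ω j) P) {c : ℝ}
    (h : ∀ j, ConvexDominated (P.map fun ω => X ω j) ((gaussianReal 0 1).map fun x => c * x)) :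
    ConvexDominated (P.map X)
      ((stdGaussian (EuclideanSpace ℝ (Fin n))).map fun g => c • g) := by
  -- The vector is the sum of its independent components along the coordinate axes, so stability
  -- under sums applies.
  let L : Fin n → ℝ →L[ℝ] EuclideanSpace ℝ (Fin n) := fun j =>
    (ContinuousLinearMap.id ℝ ℝ).smulRight (EuclideanSpace.single j (1 : ℝ))
  have hXj : ∀ j, Measurable fun ω => X ω j := fun j => by fun_prop
  have hsum : ∀ v : EuclideanSpace ℝ (Fin n), ∑ j, L j (v j) = v := fun v => by
    ext k
    simp [L, Pi.single_apply]
  let G : Measure (Fin n → ℝ) := Measure.pi fun _ => gaussianReal 0 1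
  have hY : iIndepFun (fun (j : Fin n) (g : Fin n → ℝ) => L j (c * g j)) G :=
    iIndepFun_pi (μ := fun _ : Fin n => gaussianReal 0 1) (X := fun j x => L j (c * x))
      fun j => by fun_prop
  have hX' : iIndepFun (fun (j : Fin n) ω => L j (X ω j)) P :=
    hi.comp (fun j x => L j x) fun j => (L j).continuous.measurable
  have key := ConvexDominated.map_sum (P := P) (P' := G)
    (X := fun j ω => L j (X ω j)) (Y := fun j g => L j (c * g j))
    (fun j => by fun_prop) (fun j => by fun_prop) hX' hY (fun j => ?_) Finset.univ
  · have e1 : (∑ j, fun ω => L j (X ω j)) = X := by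
      ext ω : 1
      rw [Finset.sum_apply]
      exact hsum _
    have e2 : (∑ j, fun g : Fin n → ℝ => L j (c * g j))
        = (fun g => c • g) ∘ (WithLp.toLp 2) := by
      ext g : 1
      rw [Finset.sum_apply]
      simpa using hsum (c • WithLp.toLp 2 g)
    rw [e1, e2, ← Measure.map_map (by fun_prop) (by fun_prop), map_pi_eq_stdGaussian] at key
    exact key
  · have := (h j).map (L j)
    rw [Measure.map_map (L j).continuous.measurable (hXj j),
      Measure.map_map (L j).continuous.measurable (by fun_prop)] at this
    have e : G.map (fun g => L j (c * g j))
        = (gaussianReal 0 1).map (L j ∘ fun x => c * x) := by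
      rw [← (measurePreserving_eval (fun _ : Fin n => gaussianReal 0 1) j).map_eq,
        Measure.map_map (by fun_prop) (by fun_prop)]
      rfl
    rw [e]
    exact this

/-- A sum of `m` independent vectors, each dominated by `c` times a standard Gaussian vector, is
dominated by `c √m` times a standard Gaussian vector. -/
lemma convexDominated_stdGaussian_sum {E : Type*} [NormedAddCommGroup E] [InnerProductSpace ℝ E]
    [FiniteDimensional ℝ E] [MeasurableSpace E] [BorelSpace E] {m : ℕ} {X : Fin m → Ω → E}
    (hX : ∀ i, Measurable (X i)) (hi : iIndepFun X P) {c : ℝ}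
    (h : ∀ i, ConvexDominated (P.map (X i)) ((stdGaussian E).map fun g => c • g)) :
    ConvexDominated (P.map fun ω => ∑ i, X i ω)
      ((stdGaussian E).map fun g => (c * √m) • g) := by
  let G : Measure (Fin m → E) := Measure.pi fun _ => stdGaussian E
  have hY : iIndepFun (fun (i : Fin m) (g : Fin m → E) => c • g i) G :=
    iIndepFun_pi (μ := fun _ : Fin m => stdGaussian E) (X := fun _ x => c • x)
      fun j => by fun_prop
  have e : ∀ i : Fin m, G.map (fun g => c • g i) = (stdGaussian E).map fun g => c • g := fun i => by
    rw [← (measurePreserving_eval (fun _ : Fin m => stdGaussian E) i).map_eq,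
      Measure.map_map (by fun_prop) (by fun_prop)]
    rfl
  have key := ConvexDominated.map_sum (P := P) (P' := G) hX
    (fun i => by fun_prop) hi hY (fun i => by rw [e]; exact h i) Finset.univ
  have e1 : (∑ i, X i) = fun ω => ∑ i, X i ω := Finset.sum_fn _ _
  have e2 : G.map (∑ i : Fin m, fun g : Fin m → E => c • g i)
      = (stdGaussian E).map fun g => (c * √m) • g := by
    have hp1 : IsProbabilityMeasure ((stdGaussian E).map fun g => (c * √m) • g) :=
      Measure.isProbabilityMeasure_map (by fun_prop)
    have hp2 : IsProbabilityMeasure (G.map (∑ i : Fin m, fun g : Fin m → E => c • g i)) :=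
      Measure.isProbabilityMeasure_map (Measurable.aemeasurable (by rw [Finset.sum_fn]; fun_prop))
    -- A sum of m independent copies of c g is distributed as c√m g, by comparing characteristic
    -- functions.
    refine Measure.ext_of_charFun ?_
    rw [hY.charFun_map_sum_eq_prod fun i => Measurable.aemeasurable (by fun_prop)]
    ext t
    rw [Finset.prod_apply]
    simp only [e, charFun_map_smul, charFun_stdGaussian, Finset.prod_const, Finset.card_univ,
      Fintype.card_fin, norm_smul, norm_mul]
    rw [← Complex.exp_nat_mul]
    congr 1
    push_cast
    have : (((‖√(m : ℝ)‖ : ℝ) : ℂ)) ^ 2 = m := by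
      rw [← Complex.ofReal_pow, Real.norm_eq_abs, sq_abs, Real.sq_sqrt (by positivity)]
      simp
    rw [mul_pow, mul_pow, mul_pow, this]
    ring
  rw [e1, e2] at key
  exact key

end GaussianDomination

/-! ### Support functions and their Gaussian exponential moments. -/

section SupportFunction

variable {E : Type*} [NormedAddCommGroup E] [InnerProductSpace ℝ E]

/-- The support function `v ↦ sup_{z ∈ T} ⟨v, z⟩` of a set `T`. -/
noncomputable def supportFn (T : Set E) (v : E) : ℝ := ⨆ z : T, inner ℝ v (z : E)

variable {T : Set E} {R : ℝ}

lemma inner_le_mul_norm (hT : T ⊆ Metric.closedBall 0 R) (v : E) {z : E} (hz : z ∈ T) :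
    inner ℝ v z ≤ R * ‖v‖ := by
  have h1 := real_inner_le_norm v z
  have h2 : ‖z‖ ≤ R := by simpa using hT hz
  nlinarith [norm_nonneg v]

/-- Boundedness of T makes the real supremum genuine rather than the default value 0. -/
lemma inner_le_supportFn (hT : T ⊆ Metric.closedBall 0 R) (v : E) {z : E} (hz : z ∈ T) :
    inner ℝ v z ≤ supportFn T v :=
  le_ciSup (f := fun z : T => inner ℝ v (z : E))
    ⟨R * ‖v‖, by rintro _ ⟨y, rfl⟩; exact inner_le_mul_norm hT v y.2⟩ ⟨z, hz⟩

lemma supportFn_nonneg (hT : T ⊆ Metric.closedBall 0 R) (h0 : (0 : E) ∈ T) (v : E) :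
    0 ≤ supportFn T v := by simpa using inner_le_supportFn hT v h0

lemma supportFn_le (hT : T ⊆ Metric.closedBall 0 R) (h0 : (0 : E) ∈ T) (v : E) :
    supportFn T v ≤ R * ‖v‖ :=
  haveI : Nonempty T := ⟨⟨0, h0⟩⟩
  ciSup_le fun z => inner_le_mul_norm hT v z.2

lemma supportFn_smul (T : Set E) {c : ℝ} (hc : 0 ≤ c) (v : E) :
    supportFn T (c • v) = c * supportFn T v := by
  simp only [supportFn, real_inner_smul_left]
  rw [Real.mul_iSup_of_nonneg hc]

lemma supportFn_add_le (hT : T ⊆ Metric.closedBall 0 R) (h0 : (0 : E) ∈ T) (v w : E) :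
    supportFn T (v + w) ≤ supportFn T v + supportFn T w := by
  have : Nonempty T := ⟨⟨0, h0⟩⟩
  refine ciSup_le fun z => ?_
  rw [inner_add_left]
  exact add_le_add (inner_le_supportFn hT v z.2) (inner_le_supportFn hT w z.2)

lemma convexOn_supportFn (hT : T ⊆ Metric.closedBall 0 R) (h0 : (0 : E) ∈ T) :
    ConvexOn ℝ Set.univ (supportFn T) := by
  refine ⟨convex_univ, fun v _ w _ a b ha hb _ => ?_⟩
  refine (supportFn_add_le hT h0 _ _).trans ?_
  rw [supportFn_smul T ha, supportFn_smul T hb, smul_eq_mul, smul_eq_mul]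

lemma continuous_supportFn (hT : T ⊆ Metric.closedBall 0 R) (h0 : (0 : E) ∈ T) :
    Continuous (supportFn T) := by
  have hR : 0 ≤ R := by simpa using (norm_nonneg (0 : E)).trans (mem_closedBall_zero_iff.1 (hT h0))
  refine (LipschitzWith.of_le_add_mul (K := R.toNNReal) fun v w => ?_).continuous
  have h1 := supportFn_add_le hT h0 w (v - w)
  have h2 := supportFn_le hT h0 (v - w)
  rw [add_sub_cancel] at h1
  rw [Real.coe_toNNReal _ hR, dist_eq_norm]
  linarith

variable [FiniteDimensional ℝ E] [MeasurableSpace E] [BorelSpace E]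

lemma stdGaussian_map_inner (z : E) :
    (stdGaussian E).map (fun g => inner ℝ g z) = gaussianReal 0 (‖z‖ ^ 2).toNNReal := by
  have h := IsGaussian.map_eq_gaussianReal (μ := stdGaussian E) (innerSL ℝ z)
  rw [variance_dual_stdGaussian, integral_strongDual_stdGaussian, innerSL_apply_norm] at h
  rw [← h]
  congr 1
  ext g
  simp [real_inner_comm]

lemma lintegral_exp_mul_inner_stdGaussian (a : ℝ) (z : E) :
    ∫⁻ g, ENNReal.ofReal (Real.exp (a * inner ℝ g z)) ∂(stdGaussian E)
      = ENNReal.ofReal (Real.exp (a ^ 2 * ‖z‖ ^ 2 / 2)) := by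
  have hmap := stdGaussian_map_inner z
  have hm : Measurable fun t : ℝ => ENNReal.ofReal (Real.exp (a * t)) := by fun_prop
  rw [← lintegral_map (f := fun t : ℝ => ENNReal.ofReal (Real.exp (a * t))) hm (by fun_prop), hmap,
    ← ofReal_integral_eq_lintegral_ofReal (integrable_exp_mul_gaussianReal a)
      (Filter.Eventually.of_forall fun _ => (Real.exp_pos _).le)]
  have := mgf_gaussianReal (X := id) (p := gaussianReal 0 (‖z‖ ^ 2).toNNReal)
    Measure.map_id a
  rw [mgf] at this
  simp only [id] at this
  rw [this, Real.coe_toNNReal _ (by positivity)]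
  ring_nf

/-- Fernique's theorem makes exp(C‖g‖²) integrable, and completing the square dominates a linear
exponent by a quadratic one. -/
lemma integrable_exp_norm_stdGaussian (a : ℝ) :
    Integrable (fun g => Real.exp (a * ‖g‖)) (stdGaussian E) := by
  obtain ⟨C, hC, hi⟩ := IsGaussian.exists_integrable_exp_sq (stdGaussian E)
  refine (hi.const_mul (Real.exp (a ^ 2 / (4 * C)))).mono' (by fun_prop)
    (Filter.Eventually.of_forall fun g => ?_)
  rw [Real.norm_of_nonneg (Real.exp_pos _).le, ← Real.exp_add, Real.exp_le_exp]
  have : a ^ 2 / (4 * C) + C * ‖g‖ ^ 2 - a * ‖g‖ = (a - 2 * C * ‖g‖) ^ 2 / (4 * C) := by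
    field_simp
    ring
  have h2 : 0 ≤ (a - 2 * C * ‖g‖) ^ 2 / (4 * C) := by positivity
  linarith

lemma integrable_exp_supportFn (hT : T ⊆ Metric.closedBall 0 R) (h0 : (0 : E) ∈ T) {a : ℝ}
    (ha : 0 ≤ a) : Integrable (fun g => Real.exp (a * supportFn T g)) (stdGaussian E) := by
  have hk := continuous_supportFn hT h0
  refine (integrable_exp_norm_stdGaussian (a * R)).mono' (by fun_prop)
    (Filter.Eventually.of_forall fun g => ?_)
  rw [Real.norm_of_nonneg (Real.exp_pos _).le, Real.exp_le_exp, mul_assoc]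
  exact mul_le_mul_of_nonneg_left (supportFn_le hT h0 g) ha

lemma integrable_supportFn (hT : T ⊆ Metric.closedBall 0 R) (h0 : (0 : E) ∈ T) :
    Integrable (supportFn T) (stdGaussian E) := by
  have hk := continuous_supportFn hT h0
  refine (integrable_exp_supportFn hT h0 zero_le_one).mono' (by fun_prop)
    (Filter.Eventually.of_forall fun g => ?_)
  rw [Real.norm_of_nonneg (supportFn_nonneg hT h0 g), one_mul]
  linarith [Real.add_one_le_exp (supportFn T g)]

/-- Exponential moments of the increment of a support function under a small rotation. -/
lemma lintegral_exp_supportFn_sub_le (hT : T ⊆ Metric.closedBall 0 R) (h0 : (0 : E) ∈ T)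
    {t c s : ℝ} (ht : 0 ≤ t) (hc : 0 ≤ c) :
    ∫⁻ p, ENNReal.ofReal (Real.exp (t * (supportFn T p.1 - supportFn T (c • p.1 + s • p.2))))
        ∂((stdGaussian E).prod (stdGaussian E))
      ≤ ENNReal.ofReal (Real.exp (t ^ 2 * s ^ 2 * R ^ 2 / 2))
        * ∫⁻ g, ENNReal.ofReal (Real.exp (t * (1 - c) * supportFn T g)) ∂(stdGaussian E) := by
  have hk := continuous_supportFn hT h0
  rw [lintegral_prod _ (by fun_prop), ← lintegral_const_mul _ (by fun_prop)]
  refine lintegral_mono fun g => ?_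
  have : Nonempty T := ⟨⟨0, h0⟩⟩
  have hη : ∀ η : ℝ, 0 < η →
      ∫⁻ y, ENNReal.ofReal (Real.exp (t * (supportFn T g - supportFn T (c • g + s • y))))
        ∂(stdGaussian E) ≤ ENNReal.ofReal (Real.exp (t * c * η + t ^ 2 * s ^ 2 * R ^ 2 / 2
          + t * (1 - c) * supportFn T g)) := fun η hη => by
    -- The supremum need not be attained, so z is an η-maximiser for the frozen g, and η → 0 at the
    -- end. Testing the rotated vector against this fixed z leaves only the Gaussian variable ⟨y,
    -- z⟩, of variance at most R².
    obtain ⟨⟨z, hz⟩, hzg⟩ := exists_lt_of_lt_ciSup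
      (show supportFn T g - η < ⨆ z : T, inner ℝ g (z : E) from sub_lt_self _ hη)
    simp only at hzg
    have hzR : ‖z‖ ≤ R := by simpa using hT hz
    calc ∫⁻ y, ENNReal.ofReal (Real.exp (t * (supportFn T g - supportFn T (c • g + s • y))))
        ∂(stdGaussian E)
        ≤ ∫⁻ y, ENNReal.ofReal (Real.exp (t * c * η + t * (1 - c) * supportFn T g))
          * ENNReal.ofReal (Real.exp ((-(t * s)) * inner ℝ y z)) ∂(stdGaussian E) := by
          refine lintegral_mono fun y => ?_
          rw [← ENNReal.ofReal_mul (Real.exp_pos _).le, ← Real.exp_add]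
          refine ENNReal.ofReal_le_ofReal (Real.exp_le_exp.2 ?_)
          have h1 := inner_le_supportFn hT (c • g + s • y) hz
          rw [inner_add_left, real_inner_smul_left, real_inner_smul_left] at h1
          have h2 : c * (supportFn T g - η) ≤ c * inner ℝ g z :=
            mul_le_mul_of_nonneg_left hzg.le hc
          have h3 : supportFn T g - supportFn T (c • g + s • y)
              ≤ c * η + (1 - c) * supportFn T g - s * inner ℝ y z := by linarith
          have := mul_le_mul_of_nonneg_left h3 ht
          linarith
      _ = ENNReal.ofReal (Real.exp (t * c * η + t * (1 - c) * supportFn T g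
            + t ^ 2 * s ^ 2 * ‖z‖ ^ 2 / 2)) := by
          rw [lintegral_const_mul _ (by fun_prop), lintegral_exp_mul_inner_stdGaussian,
            ← ENNReal.ofReal_mul (Real.exp_pos _).le, ← Real.exp_add]
          ring_nf
      _ ≤ _ := by
          refine ENNReal.ofReal_le_ofReal (Real.exp_le_exp.2 ?_)
          have : t ^ 2 * s ^ 2 * ‖z‖ ^ 2 ≤ t ^ 2 * s ^ 2 * R ^ 2 := by gcongr
          linarith
  rw [← ENNReal.ofReal_mul (Real.exp_pos _).le, ← Real.exp_add]
  have hlim : Filter.Tendsto (fun η : ℝ => ENNReal.ofReal (Real.exp (t * c * η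
      + t ^ 2 * s ^ 2 * R ^ 2 / 2 + t * (1 - c) * supportFn T g))) (nhdsWithin 0 (Set.Ioi 0))
      (nhds (ENNReal.ofReal (Real.exp (t ^ 2 * s ^ 2 * R ^ 2 / 2
        + t * (1 - c) * supportFn T g)))) := by
    have : Continuous fun η : ℝ => ENNReal.ofReal (Real.exp (t * c * η
      + t ^ 2 * s ^ 2 * R ^ 2 / 2 + t * (1 - c) * supportFn T g)) :=
      ENNReal.continuous_ofReal.comp (by fun_prop)
    have h := (this.tendsto 0).mono_left (nhdsWithin_le_nhds (s := Set.Ioi 0))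
    simpa using h
  exact ge_of_tendsto hlim (by filter_upwards [self_mem_nhdsWithin] with η h using hη η h)

/-- Rotating a pair of independent standard Gaussians preserves its law, and in the rotated
coordinates the angle α + θ becomes θ. -/
lemma lintegral_exp_supportFn_sub_rotation (hT : T ⊆ Metric.closedBall 0 R) (h0 : (0 : E) ∈ T)
    (t α θ : ℝ) :
    ∫⁻ p, ENNReal.ofReal (Real.exp (t * (supportFn T (Real.cos α • p.1 + Real.sin α • p.2)
        - supportFn T (Real.cos (α + θ) • p.1 + Real.sin (α + θ) • p.2))))
        ∂((stdGaussian E).prod (stdGaussian E))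
      = ∫⁻ p, ENNReal.ofReal (Real.exp (t * (supportFn T p.1
        - supportFn T (Real.cos θ • p.1 + Real.sin θ • p.2))))
        ∂((stdGaussian E).prod (stdGaussian E)) := by
  have hk := continuous_supportFn hT h0
  conv_rhs => rw [← IsGaussian.map_rotation_eq_self (μ := stdGaussian E) (by simp) α]
  rw [lintegral_map (by fun_prop) (by fun_prop)]
  refine lintegral_congr fun p => ?_
  have e : Real.cos (α + θ) • p.1 + Real.sin (α + θ) • p.2
      = Real.cos θ • (Real.cos α • p.1 + Real.sin α • p.2)
        + Real.sin θ • (-Real.sin α • p.1 + Real.cos α • p.2) := by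
    rw [Real.cos_add, Real.sin_add]
    module
  rw [ContinuousLinearMap.rotation_apply, e]

lemma exp_mul_add_add_le (t a b c : ℝ) :
    Real.exp (t * (a + b + c))
      ≤ 1 / 3 * (Real.exp (3 * t * a) + Real.exp (3 * t * b) + Real.exp (3 * t * c)) := by
  have := convexOn_exp.map_sum_le (t := Finset.univ) (w := fun _ : Fin 3 => (1 / 3 : ℝ))
    (p := ![3 * t * a, 3 * t * b, 3 * t * c]) (by simp) (by simp) (by simp)
  simp only [Fin.sum_univ_three, smul_eq_mul] at this
  simp at this
  rw [show t * (a + b + c) = 3⁻¹ * (3 * t * a) + 3⁻¹ * (3 * t * b) + 3⁻¹ * (3 * t * c) by ring]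
  linarith

/-- Gaussian concentration, in exponential-moment form, for the support function of a bounded
set. -/
theorem lintegral_exp_supportFn_le (hT : T ⊆ Metric.closedBall 0 R) (h0 : (0 : E) ∈ T)
    {t : ℝ} (ht : 0 ≤ t) :
    ∫⁻ g, ENNReal.ofReal (Real.exp (t * supportFn T g)) ∂(stdGaussian E)
      ≤ ENNReal.ofReal (Real.exp (2 * t * (∫ g, supportFn T g ∂(stdGaussian E))
        + 9 / 4 * t ^ 2 * R ^ 2)) := by
  have hk := continuous_supportFn hT h0
  set γ := stdGaussian E with hγ
  set w := ∫ g, supportFn T g ∂γ with hw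
  have hJ : ENNReal.ofReal (Real.exp (-(t * w)))
      ≤ ∫⁻ g, ENNReal.ofReal (Real.exp (-(t * supportFn T g))) ∂γ := by
    have := convexOn_exp.ofReal_map_integral_le (P := γ) Real.continuous_exp
      (fun x => (Real.exp_pos x).le) ((integrable_supportFn hT h0).const_mul t).neg
    simp only [Pi.neg_apply, integral_neg, integral_const_mul] at this
    exact this
  have hcos : Real.cos (Real.pi / 6 + Real.pi / 6 + Real.pi / 6) = 0 := by
    rw [show Real.pi / 6 + Real.pi / 6 + Real.pi / 6 = Real.pi / 2 by ring, Real.cos_pi_div_two]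
  have hsin : Real.sin (Real.pi / 6 + Real.pi / 6 + Real.pi / 6) = 1 := by
    rw [show Real.pi / 6 + Real.pi / 6 + Real.pi / 6 = Real.pi / 2 by ring, Real.sin_pi_div_two]
  -- The path from g to an independent copy is a rotation by π/2, cut into three rotations by π/6.
  -- Convexity of exp splits the increment, and each piece contributes the same D.
  set D := ∫⁻ p, ENNReal.ofReal (Real.exp (3 * t * (supportFn T p.1
        - supportFn T (Real.cos (Real.pi / 6) • p.1 + Real.sin (Real.pi / 6) • p.2))))
        ∂(γ.prod γ) with hD
  have h1 : (∫⁻ g, ENNReal.ofReal (Real.exp (t * supportFn T g)) ∂γ)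
      * ENNReal.ofReal (Real.exp (-(t * w))) ≤ D := by
    calc (∫⁻ g, ENNReal.ofReal (Real.exp (t * supportFn T g)) ∂γ)
          * ENNReal.ofReal (Real.exp (-(t * w)))
        ≤ (∫⁻ g, ENNReal.ofReal (Real.exp (t * supportFn T g)) ∂γ)
          * ∫⁻ g, ENNReal.ofReal (Real.exp (-(t * supportFn T g))) ∂γ := by gcongr
      _ = ∫⁻ p, ENNReal.ofReal (Real.exp (t * (supportFn T p.1 - supportFn T p.2)))
          ∂(γ.prod γ) := by
          rw [← lintegral_prod_mul (by fun_prop) (by fun_prop)]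
          refine lintegral_congr fun p => ?_
          rw [← ENNReal.ofReal_mul (Real.exp_pos _).le, ← Real.exp_add]
          ring_nf
      _ ≤ ∫⁻ p, ENNReal.ofReal (1 / 3) * (ENNReal.ofReal (Real.exp (3 * t * (supportFn T
              (Real.cos 0 • p.1 + Real.sin 0 • p.2)
              - supportFn T (Real.cos (0 + Real.pi / 6) • p.1
                + Real.sin (0 + Real.pi / 6) • p.2))))
            + ENNReal.ofReal (Real.exp (3 * t * (supportFn T
              (Real.cos (Real.pi / 6) • p.1 + Real.sin (Real.pi / 6) • p.2)
              - supportFn T (Real.cos (Real.pi / 6 + Real.pi / 6) • p.1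
                + Real.sin (Real.pi / 6 + Real.pi / 6) • p.2))))
            + ENNReal.ofReal (Real.exp (3 * t * (supportFn T
              (Real.cos (Real.pi / 6 + Real.pi / 6) • p.1
                + Real.sin (Real.pi / 6 + Real.pi / 6) • p.2)
              - supportFn T (Real.cos (Real.pi / 6 + Real.pi / 6 + Real.pi / 6) • p.1
                + Real.sin (Real.pi / 6 + Real.pi / 6 + Real.pi / 6) • p.2))))) ∂(γ.prod γ) := by
          refine lintegral_mono fun p => ?_
          rw [← ENNReal.ofReal_add (Real.exp_pos _).le (Real.exp_pos _).le,
            ← ENNReal.ofReal_add (by positivity) (Real.exp_pos _).le,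
            ← ENNReal.ofReal_mul (by norm_num)]
          refine ENNReal.ofReal_le_ofReal (le_trans (le_of_eq ?_) (exp_mul_add_add_le t _ _ _))
          rw [hcos, hsin]
          simp
      _ = ENNReal.ofReal (1 / 3) * (D + D + D) := by
          rw [lintegral_const_mul _ (by fun_prop), lintegral_add_right _ (by fun_prop),
            lintegral_add_right _ (by fun_prop), lintegral_exp_supportFn_sub_rotation hT h0,
            lintegral_exp_supportFn_sub_rotation hT h0, lintegral_exp_supportFn_sub_rotation hT h0]
      _ = D := by
          rw [show D + D + D = ENNReal.ofReal 3 * D by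
            rw [show ENNReal.ofReal 3 = 3 by simp]; ring, ← mul_assoc,
            ← ENNReal.ofReal_mul (by norm_num)]
          norm_num
  -- Three is the least number k of steps with k(1 - cos(π/(2k))) ≤ 1/2; then D involves the
  -- exponential moment only at t/2.
  have hcos' : (3 : ℝ) * (1 - Real.cos (Real.pi / 6)) ≤ 1 / 2 := by
    rw [Real.cos_pi_div_six]
    have : (5 / 3 : ℝ) ≤ √3 := Real.le_sqrt_of_sq_le (by norm_num)
    linarith
  have h2 : D ≤ ENNReal.ofReal (Real.exp (9 / 8 * t ^ 2 * R ^ 2))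
      * ∫⁻ g, ENNReal.ofReal (Real.exp (t / 2 * supportFn T g)) ∂γ := by
    have hcpos : 0 ≤ Real.cos (Real.pi / 6) := by rw [Real.cos_pi_div_six]; positivity
    refine (lintegral_exp_supportFn_sub_le hT h0 (by positivity) hcpos).trans ?_
    refine mul_le_mul' (le_of_eq ?_) (lintegral_mono fun g => ?_)
    · rw [Real.sin_pi_div_six]
      ring_nf
    · refine ENNReal.ofReal_le_ofReal (Real.exp_le_exp.2 ?_)
      have h3 := supportFn_nonneg hT h0 g
      refine mul_le_mul_of_nonneg_right ?_ h3
      nlinarith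
  have hi1 := integrable_exp_supportFn hT h0 ht
  have hi2 := integrable_exp_supportFn hT h0 (a := t / 2) (by positivity)
  have h3 : (∫ g, Real.exp (t / 2 * supportFn T g) ∂γ) ^ 2
      ≤ ∫ g, Real.exp (t * supportFn T g) ∂γ := by
    have := (convexOn_pow 2).map_integral_le (μ := γ)
      (f := fun g => Real.exp (t / 2 * supportFn T g)) (continuous_pow 2).continuousOn isClosed_Ici
      (Filter.Eventually.of_forall fun g => (Real.exp_pos _).le) hi2 (by
        refine hi1.congr (Filter.Eventually.of_forall fun g => ?_)
        simp only [Function.comp_apply, ← Real.exp_nat_mul]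
        push_cast
        ring_nf)
    refine this.trans (le_of_eq (integral_congr_ae (Filter.Eventually.of_forall fun g => ?_)))
    simp only [← Real.exp_nat_mul]
    push_cast
    ring_nf
  rw [← ofReal_integral_eq_lintegral_ofReal hi1
    (Filter.Eventually.of_forall fun _ => (Real.exp_pos _).le)] at h1 ⊢
  rw [← ofReal_integral_eq_lintegral_ofReal hi2
    (Filter.Eventually.of_forall fun _ => (Real.exp_pos _).le)] at h2
  have h4 := h1.trans h2
  have ha : 0 ≤ ∫ g, Real.exp (t * supportFn T g) ∂γ :=
    integral_nonneg fun _ => (Real.exp_pos _).le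
  have hb : 0 ≤ ∫ g, Real.exp (t / 2 * supportFn T g) ∂γ :=
    integral_nonneg fun _ => (Real.exp_pos _).le
  set a := ∫ g, Real.exp (t * supportFn T g) ∂γ
  set b := ∫ g, Real.exp (t / 2 * supportFn T g) ∂γ
  rw [← ENNReal.ofReal_mul ha, ← ENNReal.ofReal_mul (Real.exp_pos _).le,
    ENNReal.ofReal_le_ofReal_iff (by positivity), Real.exp_neg, ← div_eq_mul_inv,
    div_le_iff₀ (Real.exp_pos _)] at h4
  refine ENNReal.ofReal_le_ofReal ?_
  rcases ha.eq_or_lt with ha0 | ha0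
  · rw [← ha0]
    positivity
  -- By now a ≤ exp(9t²R²/8 + tw) b with b² ≤ a. Squaring and dividing by the finite number a closes
  -- the self-referential estimate.
  have h5 : a * a ≤ Real.exp (2 * t * w + 9 / 4 * t ^ 2 * R ^ 2) * a := by
    calc a * a = a ^ 2 := by ring
      _ ≤ (Real.exp (9 / 8 * t ^ 2 * R ^ 2) * b * Real.exp (t * w)) ^ 2 := by gcongr
      _ = Real.exp (2 * t * w + 9 / 4 * t ^ 2 * R ^ 2) * b ^ 2 := by
          rw [mul_pow, mul_pow, ← Real.exp_nat_mul, ← Real.exp_nat_mul,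
            show 2 * t * w + 9 / 4 * t ^ 2 * R ^ 2
              = ((2 : ℕ) : ℝ) * (9 / 8 * t ^ 2 * R ^ 2) + ((2 : ℕ) : ℝ) * (t * w) by
              push_cast; ring, Real.exp_add]
          ring
      _ ≤ _ := by gcongr
  exact le_of_mul_le_mul_right h5 ha0

end SupportFunction

/-! ### From total variation to a quadratic coupling, and to first moments of linear forms. -/

section Coupling

/-- The Cauchy–Schwarz bound for mass at most ε and fourth moment at most R⁴, written as the
weighted inequality x² ≤ √ε x⁴/(2R²) + R²/(2√ε). It is meant for the parts of μ and ν that differ.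
-/
lemma lintegral_sq_le_of_le {μ ρ : Measure ℝ} (hρ : ρ ≤ μ) {ε R : ℝ} (hε : 0 < ε) (hR : 0 < R)
    (hm : ρ Set.univ ≤ ENNReal.ofReal ε)
    (h4 : ∫⁻ x, ENNReal.ofReal (x ^ 4) ∂μ ≤ ENNReal.ofReal (R ^ 4)) :
    ∫⁻ x, ENNReal.ofReal (x ^ 2) ∂ρ ≤ ENNReal.ofReal (R ^ 2 * √ε) := by
  have hs : 0 < √ε := Real.sqrt_pos.2 hε
  have hss : √ε * √ε = ε := Real.mul_self_sqrt hε.le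
  calc ∫⁻ x, ENNReal.ofReal (x ^ 2) ∂ρ
      ≤ ∫⁻ x, (ENNReal.ofReal (√ε / (2 * R ^ 2)) * ENNReal.ofReal (x ^ 4)
          + ENNReal.ofReal (R ^ 2 / (2 * √ε))) ∂ρ := by
        refine lintegral_mono fun x => ?_
        rw [← ENNReal.ofReal_mul (by positivity), ← ENNReal.ofReal_add (by positivity)
          (by positivity)]
        refine ENNReal.ofReal_le_ofReal ?_
        have e : √ε / (2 * R ^ 2) * x ^ 4 + R ^ 2 / (2 * √ε) - x ^ 2
            = (√ε * x ^ 2 - R ^ 2) ^ 2 / (2 * R ^ 2 * √ε) := by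
          field_simp
          ring
        have : 0 ≤ (√ε * x ^ 2 - R ^ 2) ^ 2 / (2 * R ^ 2 * √ε) := by positivity
        linarith
    _ = ENNReal.ofReal (√ε / (2 * R ^ 2)) * ∫⁻ x, ENNReal.ofReal (x ^ 4) ∂ρ
          + ENNReal.ofReal (R ^ 2 / (2 * √ε)) * ρ Set.univ := by
        rw [lintegral_add_right _ (by fun_prop), lintegral_const_mul _ (by fun_prop),
          lintegral_const]
    _ ≤ ENNReal.ofReal (√ε / (2 * R ^ 2)) * ENNReal.ofReal (R ^ 4)
          + ENNReal.ofReal (R ^ 2 / (2 * √ε)) * ENNReal.ofReal ε := by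
        gcongr
        exact (lintegral_mono' hρ le_rfl).trans h4
    _ = ENNReal.ofReal (R ^ 2 * √ε) := by
        rw [← ENNReal.ofReal_mul (by positivity), ← ENNReal.ofReal_mul (by positivity),
          ← ENNReal.ofReal_add (by positivity) (by positivity)]
        congr 1
        field_simp
        rw [show √ε ^ 2 = ε by rw [sq, hss]]
        ring

/-- Two distributions on the line that are `ε`-close in total variation and have bounded fourth
moments admit a coupling with small quadratic cost. -/
lemma exists_coupling_sq_le {μ ν : Measure ℝ} [IsProbabilityMeasure μ] [IsProbabilityMeasure ν]
    {ε R : ℝ} (hε : 0 < ε) (hR : 0 < R)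
    (htv : ∀ A, MeasurableSet A → |μ.real A - ν.real A| ≤ ε)
    (hμ : ∫⁻ x, ENNReal.ofReal (x ^ 4) ∂μ ≤ ENNReal.ofReal (R ^ 4))
    (hν : ∫⁻ x, ENNReal.ofReal (x ^ 4) ∂ν ≤ ENNReal.ofReal (R ^ 4)) :
    ∃ π : Measure (ℝ × ℝ), π.map Prod.fst = μ ∧ π.map Prod.snd = ν ∧
      ∫⁻ z, ENNReal.ofReal ((z.1 - z.2) ^ 2) ∂π ≤ ENNReal.ofReal (4 * R ^ 2 * √ε) := by
  obtain ⟨H, hH, hH1, hH2⟩ := hahn_decomposition μ ν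
  have hle1 : ν.restrict H ≤ μ.restrict H := by
    refine Measure.le_iff.2 fun s hs => ?_
    rw [Measure.restrict_apply hs, Measure.restrict_apply hs]
    exact hH1 _ (hs.inter hH) Set.inter_subset_right
  have hle2 : μ.restrict Hᶜ ≤ ν.restrict Hᶜ := by
    refine Measure.le_iff.2 fun s hs => ?_
    rw [Measure.restrict_apply hs, Measure.restrict_apply hs]
    exact hH2 _ (hs.inter hH.compl) Set.inter_subset_right
  -- On the Hahn decomposition, η is the common part of μ and ν, while ρ₁ and ρ₂ are the excesses of
  -- one over the other; `hle1` and `hle2` make the truncated differences genuine. The coupling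
  -- leaves η on the diagonal and pairs the excesses independently.
  set ρ₁ := μ.restrict H - ν.restrict H with hρ₁
  set ρ₂ := ν.restrict Hᶜ - μ.restrict Hᶜ with hρ₂
  set η := ν.restrict H + μ.restrict Hᶜ with hη
  have hsum1 : ρ₁ + η = μ := by
    rw [hη, ← add_assoc, Measure.sub_add_cancel_of_le hle1,
      Measure.restrict_add_restrict_compl hH]
  have hsum2 : ρ₂ + η = ν := by
    rw [hη, add_comm (ν.restrict H), ← add_assoc, Measure.sub_add_cancel_of_le hle2, add_comm,
      Measure.restrict_add_restrict_compl hH]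
  have hρ₁μ : ρ₁ ≤ μ := by
    conv_rhs => rw [← hsum1]
    exact Measure.le_add_right le_rfl
  have hρ₂ν : ρ₂ ≤ ν := by
    conv_rhs => rw [← hsum2]
    exact Measure.le_add_right le_rfl
  have hηf : η Set.univ ≠ ∞ := measure_ne_top _ _
  have hd : ρ₂ Set.univ = ρ₁ Set.univ := by
    refine (ENNReal.add_left_inj hηf).1 ?_
    rw [← Measure.add_apply, ← Measure.add_apply, hsum1, hsum2]
    simp
  set d := ρ₁ Set.univ with hd1
  have hdtop : d ≠ ∞ := measure_ne_top _ _
  have hdε : d ≤ ENNReal.ofReal ε := by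
    have h1 : d = μ H - ν H := by
      rw [hd1, hρ₁, Measure.sub_apply MeasurableSet.univ hle1]
      simp
    rw [h1, tsub_le_iff_right, ← ofReal_measureReal, ← ofReal_measureReal,
      ← ENNReal.ofReal_add hε.le measureReal_nonneg]
    refine ENNReal.ofReal_le_ofReal ?_
    have := (abs_le.1 (htv H hH)).2
    linarith
  have hρ₁0 : d = 0 → ρ₁ = 0 := fun h => Measure.measure_univ_eq_zero.1 h
  have hρ₂0 : d = 0 → ρ₂ = 0 := fun h => Measure.measure_univ_eq_zero.1 (hd.trans h)
  -- If d = 0 then d⁻¹ = ∞, which is harmless because both excesses vanish.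
  have hcancel : ∀ ρ : Measure ℝ, (d = 0 → ρ = 0) → d⁻¹ • d • ρ = ρ := fun ρ h => by
    by_cases h0 : d = 0
    · simp [h h0]
    · rw [smul_smul, ENNReal.inv_mul_cancel h0 hdtop, one_smul]
  have hdiag : Measurable fun x : ℝ => (x, x) := by fun_prop
  refine ⟨d⁻¹ • ρ₁.prod ρ₂ + η.map fun x => (x, x), ?_, ?_, ?_⟩
  · rw [Measure.map_add _ _ measurable_fst, Measure.map_smul, Measure.map_fst_prod, hd,
      hcancel _ hρ₁0, Measure.map_map measurable_fst hdiag]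
    simpa [Function.comp_def] using hsum1
  · rw [Measure.map_add _ _ measurable_snd, Measure.map_smul, Measure.map_snd_prod, ← hd1,
      hcancel _ hρ₂0, Measure.map_map measurable_snd hdiag]
    simpa [Function.comp_def] using hsum2
  · have hA := lintegral_sq_le_of_le hρ₁μ hε hR hdε hμ
    have hB := lintegral_sq_le_of_le hρ₂ν hε hR (hd.trans_le hdε) hν
    have h1 : ∫⁻ z, ENNReal.ofReal ((z.1 - z.2) ^ 2) ∂(ρ₁.prod ρ₂)
        ≤ d * ENNReal.ofReal (4 * R ^ 2 * √ε) := by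
      calc ∫⁻ z, ENNReal.ofReal ((z.1 - z.2) ^ 2) ∂(ρ₁.prod ρ₂)
          ≤ ∫⁻ z, (2 * ENNReal.ofReal (z.1 ^ 2) * 1 + 1 * (2 * ENNReal.ofReal (z.2 ^ 2)))
              ∂(ρ₁.prod ρ₂) := by
            refine lintegral_mono fun z => ?_
            rw [mul_one, one_mul, ← mul_add, ← ENNReal.ofReal_add (by positivity) (by positivity),
              show (2 : ℝ≥0∞) = ENNReal.ofReal 2 by simp, ← ENNReal.ofReal_mul (by norm_num)]
            exact ENNReal.ofReal_le_ofReal (by nlinarith [sq_nonneg (z.1 + z.2)])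
        _ = 2 * (∫⁻ x, ENNReal.ofReal (x ^ 2) ∂ρ₁) * d
              + d * (2 * ∫⁻ x, ENNReal.ofReal (x ^ 2) ∂ρ₂) := by
            rw [lintegral_add_left (by fun_prop),
              lintegral_prod_mul (f := fun x : ℝ => 2 * ENNReal.ofReal (x ^ 2))
                (g := fun _ : ℝ => 1) (by fun_prop) (by fun_prop),
              lintegral_prod_mul (f := fun _ : ℝ => 1)
                (g := fun x : ℝ => 2 * ENNReal.ofReal (x ^ 2)) (by fun_prop) (by fun_prop),
              lintegral_const_mul _ (by fun_prop), lintegral_const_mul _ (by fun_prop),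
              lintegral_one, lintegral_one, hd]
        _ ≤ 2 * ENNReal.ofReal (R ^ 2 * √ε) * d + d * (2 * ENNReal.ofReal (R ^ 2 * √ε)) := by
            gcongr
        _ = d * ENNReal.ofReal (4 * R ^ 2 * √ε) := by
            rw [mul_assoc 4, ENNReal.ofReal_mul (by norm_num : (0 : ℝ) ≤ 4),
              show ENNReal.ofReal 4 = 4 by simp]
            ring
    rw [lintegral_add_measure, lintegral_smul_measure, lintegral_map (by fun_prop) hdiag]
    simp only [sub_self, ne_eq, OfNat.ofNat_ne_zero, not_false_eq_true, zero_pow,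
      ENNReal.ofReal_zero, lintegral_zero, add_zero, smul_eq_mul]
    calc d⁻¹ * ∫⁻ z, ENNReal.ofReal ((z.1 - z.2) ^ 2) ∂(ρ₁.prod ρ₂)
        ≤ d⁻¹ * (d * ENNReal.ofReal (4 * R ^ 2 * √ε)) := by gcongr
      _ = (d⁻¹ * d) * ENNReal.ofReal (4 * R ^ 2 * √ε) := (mul_assoc _ _ _).symm
      _ ≤ 1 * ENNReal.ofReal (4 * R ^ 2 * √ε) := by
          gcongr
          exact ENNReal.inv_mul_le_one _
      _ = _ := one_mul _

lemma integral_abs_le_sqrt {Ω : Type*} [MeasurableSpace Ω] {P : Measure Ω}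
    [IsProbabilityMeasure P] {W : Ω → ℝ} (hW : MemLp W 2 P) :
    ∫ ω, |W ω| ∂P ≤ √(∫ ω, W ω ^ 2 ∂P) := by
  refine Real.le_sqrt_of_sq_le ?_
  have h := variance_eq_sub hW.abs
  have h0 := variance_nonneg |W| P
  simp only [Pi.pow_apply, Pi.abs_apply, sq_abs] at h
  linarith

lemma memLp_comp_eval {n : ℕ} {α : Type*} [MeasurableSpace α] {π : Measure α}
    [IsProbabilityMeasure π] {f : α → ℝ} (hf : MemLp f 2 π) (j : Fin n) :
    MemLp (fun p : Fin n → α => f (p j)) 2 (Measure.pi fun _ => π) :=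
  MemLp.comp_measurePreserving hf (measurePreserving_eval (fun _ => π) j)

/-- The first absolute moments of two linear forms with i.i.d. coefficients are close when the
distributions of the coefficients admit a coupling with small quadratic cost. -/
lemma abs_integral_abs_sum_sub_le {n : ℕ} {μ ν : Measure ℝ} [IsProbabilityMeasure μ]
    [IsProbabilityMeasure ν] {π : Measure (ℝ × ℝ)} (h1 : π.map Prod.fst = μ)
    (h2 : π.map Prod.snd = ν) (hμi : Integrable id μ) (hνi : Integrable id ν)
    (hμ0 : ∫ x, x ∂μ = 0) (hν0 : ∫ x, x ∂ν = 0) {D : ℝ} (hD : 0 ≤ D)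
    (hπ : ∫⁻ z, ENNReal.ofReal ((z.1 - z.2) ^ 2) ∂π ≤ ENNReal.ofReal (D ^ 2))
    (y : EuclideanSpace ℝ (Fin n)) :
    |(∫ s, |∑ j, s j * y j| ∂(Measure.pi fun _ : Fin n => μ))
      - ∫ t, |∑ j, t j * y j| ∂(Measure.pi fun _ : Fin n => ν)| ≤ D * ‖y‖ := by
  have hπp : IsProbabilityMeasure π := by
    have : IsProbabilityMeasure (π.map Prod.fst) := by rw [h1]; infer_instance
    exact Measure.isProbabilityMeasure_of_map Prod.fst
  have hp1 : MeasurePreserving Prod.fst π μ := ⟨measurable_fst, h1⟩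
  have hp2 : MeasurePreserving Prod.snd π ν := ⟨measurable_snd, h2⟩
  set Q : Measure (Fin n → ℝ × ℝ) := Measure.pi fun _ => π with hQ
  have hq1 : MeasurePreserving (fun (p : Fin n → ℝ × ℝ) j => (p j).1) Q
      (Measure.pi fun _ => μ) := measurePreserving_pi _ _ fun _ => hp1
  have hq2 : MeasurePreserving (fun (p : Fin n → ℝ × ℝ) j => (p j).2) Q
      (Measure.pi fun _ => ν) := measurePreserving_pi _ _ fun _ => hp2
  have hi1 : Integrable (fun z : ℝ × ℝ => z.1) π := hp1.integrable_comp_of_integrable hμi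
  have hi2 : Integrable (fun z : ℝ × ℝ => z.2) π := hp2.integrable_comp_of_integrable hνi
  have hI1 : Integrable (fun p : Fin n → ℝ × ℝ => ∑ j, (p j).1 * y j) Q :=
    integrable_finsetSum _ fun j _ =>
      ((measurePreserving_eval (fun _ => π) j).integrable_comp_of_integrable hi1).mul_const _
  have hI2 : Integrable (fun p : Fin n → ℝ × ℝ => ∑ j, (p j).2 * y j) Q :=
    integrable_finsetSum _ fun j _ =>
      ((measurePreserving_eval (fun _ => π) j).integrable_comp_of_integrable hi2).mul_const _
  have hs : ∀ y : EuclideanSpace ℝ (Fin n), Measurable fun s : Fin n → ℝ => |∑ j, s j * y j| :=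
    fun y => by fun_prop
  rw [← hq1.map_eq, ← hq2.map_eq,
    integral_map hq1.measurable.aemeasurable (hs y).aestronglyMeasurable,
    integral_map hq2.measurable.aemeasurable (hs y).aestronglyMeasurable,
    ← integral_sub hI1.abs hI2.abs]
  have hX2 : MemLp (fun z : ℝ × ℝ => z.1 - z.2) 2 π := by
    refine (memLp_two_iff_integrable_sq (by fun_prop)).2 ⟨by fun_prop, ?_⟩
    rw [hasFiniteIntegral_iff_ofReal (Filter.Eventually.of_forall fun z => sq_nonneg _)]
    exact hπ.trans_lt ENNReal.ofReal_lt_top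
  have hXsq : ∫ z, (z.1 - z.2) ^ 2 ∂π ≤ D ^ 2 := by
    rw [integral_eq_lintegral_of_nonneg_ae (Filter.Eventually.of_forall fun z => sq_nonneg _)
      (by fun_prop)]
    exact ENNReal.toReal_le_of_le_ofReal (by positivity) hπ
  have hX0 : ∫ z, (z.1 - z.2) ∂π = 0 := by
    rw [integral_sub hi1 hi2, ← integral_map (f := fun x => x) measurable_fst.aemeasurable
      (by fun_prop), ← integral_map (f := fun x => x) measurable_snd.aemeasurable (by fun_prop),
      h1, h2, hμ0, hν0, sub_zero]
  have hYj : ∀ j : Fin n, MemLp (fun z : ℝ × ℝ => (z.1 - z.2) * y j) 2 π := fun j =>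
    hX2.mul_const _
  -- Under n independent copies of the coupling the centred differences are independent, so
  -- variances add and the bound carries no dimensional factor.
  have hvar := variance_sum_pi (μ := fun _ : Fin n => π)
    (X := fun j z => (z.1 - z.2) * y j) hYj
  rw [Finset.sum_fn] at hvar
  have hQj : ∀ j : Fin n, MemLp (fun p : Fin n → ℝ × ℝ => ((p j).1 - (p j).2) * y j) 2 Q :=
    fun j => memLp_comp_eval (hYj j) j
  have hW2 : MemLp (fun p : Fin n → ℝ × ℝ => ∑ j : Fin n, ((p j).1 - (p j).2) * y j) 2 Q :=
    memLp_finsetSum _ fun j _ => hQj j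
  have hW0 : ∫ p, (∑ j : Fin n, ((p j).1 - (p j).2) * y j) ∂Q = 0 := by
    rw [integral_finsetSum _ fun j _ => (hQj j).integrable one_le_two]
    refine Finset.sum_eq_zero fun j _ => ?_
    rw [integral_mul_const]
    have := integral_map (μ := Q) (φ := fun p : Fin n → ℝ × ℝ => p j)
      (f := fun z : ℝ × ℝ => z.1 - z.2) (measurable_pi_apply j).aemeasurable (by fun_prop)
    rw [(measurePreserving_eval (fun _ : Fin n => π) j).map_eq, hX0] at this
    rw [← this, zero_mul]
  have hWsq : ∫ p, (∑ j : Fin n, ((p j).1 - (p j).2) * y j) ^ 2 ∂Q ≤ (D * ‖y‖) ^ 2 := by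
    rw [← variance_of_integral_eq_zero hW2.aestronglyMeasurable.aemeasurable hW0, hvar, mul_pow,
      EuclideanSpace.norm_sq_eq, Finset.mul_sum]
    refine Finset.sum_le_sum fun j _ => ?_
    refine (variance_le_expectation_sq (by fun_prop)).trans ?_
    simp only [Pi.pow_apply, mul_pow]
    rw [integral_mul_const, Real.norm_eq_abs, sq_abs]
    gcongr
  calc |∫ p, (|∑ j, (p j).1 * y j| - |∑ j, (p j).2 * y j|) ∂Q|
      ≤ ∫ p, |(|∑ j, (p j).1 * y j| - |∑ j, (p j).2 * y j|)| ∂Q := abs_integral_le_integral_abs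
    _ ≤ ∫ p, |∑ j : Fin n, ((p j).1 - (p j).2) * y j| ∂Q := by
        refine integral_mono (hI1.abs.sub hI2.abs).abs (hW2.integrable one_le_two).abs fun p => ?_
        refine (abs_abs_sub_abs_le_abs_sub _ _).trans (le_of_eq ?_)
        rw [← Finset.sum_sub_distrib]
        simp only [sub_mul]
    _ ≤ √(∫ p, (∑ j : Fin n, ((p j).1 - (p j).2) * y j) ^ 2 ∂Q) := integral_abs_le_sqrt hW2
    _ ≤ D * ‖y‖ := Real.sqrt_le_iff.2 ⟨by positivity, hWsq⟩

/-- The first absolute moment of a standard Gaussian variable. -/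
noncomputable def gaussianAbsMoment : ℝ := ∫ t, |t| ∂(gaussianReal 0 1)

lemma gaussianAbsMoment_pos : 0 < gaussianAbsMoment := by
  have hi : Integrable (fun t : ℝ => |t|) (gaussianReal 0 1) :=
    (IsGaussian.integrable_id (μ := gaussianReal 0 1)).abs
  rw [gaussianAbsMoment, integral_pos_iff_support_of_nonneg (fun t => abs_nonneg t) hi]
  have : Function.support (fun t : ℝ => |t|) = {0}ᶜ := by ext; simp
  have hna : NullSingletonClass (gaussianReal 0 1) := nullSingletonClass_gaussianReal one_ne_zero
  rw [this, prob_compl_eq_one_sub (measurableSet_singleton _), measure_singleton]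
  simp

/-- The linear form is N(0, ‖y‖²) by rotation invariance; this is the exact case that the coupling
perturbs. -/
lemma integral_abs_sum_gaussianReal {n : ℕ} (y : EuclideanSpace ℝ (Fin n)) :
    ∫ t, |∑ j, t j * y j| ∂(Measure.pi fun _ : Fin n => gaussianReal 0 1)
      = gaussianAbsMoment * ‖y‖ := by
  have e1 : ∫ t, |∑ j, t j * y j| ∂(Measure.pi fun _ : Fin n => gaussianReal 0 1)
      = ∫ g, |inner ℝ g y| ∂(stdGaussian (EuclideanSpace ℝ (Fin n))) := by
    rw [← map_pi_eq_stdGaussian, integral_map (by fun_prop) (by fun_prop)]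
    refine integral_congr_ae (Filter.Eventually.of_forall fun t => ?_)
    simp [PiLp.inner_apply, mul_comm]
  have e2 : ∫ g, |inner ℝ g y| ∂(stdGaussian (EuclideanSpace ℝ (Fin n)))
      = ∫ t, |t| ∂(gaussianReal 0 (‖y‖ ^ 2).toNNReal) := by
    rw [← stdGaussian_map_inner y, integral_map (by fun_prop) (by fun_prop)]
  have e3 : gaussianReal 0 (‖y‖ ^ 2).toNNReal = (gaussianReal 0 1).map (‖y‖ * ·) := by
    rw [gaussianReal_map_const_mul]
    congr 1
    · simp
    · ext
      simp
  rw [e1, e2, e3, integral_map (by fun_prop) (by fun_prop), gaussianAbsMoment, mul_comm,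
    ← integral_const_mul]
  simp [abs_mul]

/-- The crude bound x⁴ ≤ 24 exp|x| ≤ 24(exp x + exp(-x)) suffices, since only an absolute constant
matters; 80 comes from 48 √e with √e ≤ 5/3. -/
lemma lintegral_pow_four_gaussianReal_le :
    ∫⁻ x, ENNReal.ofReal (x ^ 4) ∂(gaussianReal 0 1) ≤ ENNReal.ofReal 80 := by
  have hi := fun a : ℝ => integrable_exp_mul_gaussianReal (μ := 0) (v := 1) a
  have hm : ∀ a : ℝ, ∫ x, Real.exp (a * x) ∂(gaussianReal 0 1) = Real.exp (a ^ 2 / 2) := fun a => by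
    have := mgf_gaussianReal (X := id) (p := gaussianReal 0 1) Measure.map_id a
    simpa [mgf] using this
  have hb : ∀ x : ℝ, x ^ 4 ≤ 24 * (Real.exp (1 * x) + Real.exp (-1 * x)) := fun x => by
    have h1 := Real.pow_div_factorial_le_exp |x| (abs_nonneg x) 4
    have h2 : |x| ^ 4 = x ^ 4 := by rw [show 4 = 2 * 2 by norm_num, pow_mul, sq_abs, ← pow_mul]
    rw [h2, div_le_iff₀ (by positivity), show ((Nat.factorial 4 : ℕ) : ℝ) = 24 by
      norm_num [Nat.factorial]] at h1
    have h3 : Real.exp |x| ≤ Real.exp (1 * x) + Real.exp (-1 * x) := by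
      rcases abs_choice x with h | h <;> rw [h]
      · simpa using (Real.exp_pos (-x)).le
      · simpa using (Real.exp_pos x).le
    linarith
  calc ∫⁻ x, ENNReal.ofReal (x ^ 4) ∂(gaussianReal 0 1)
      ≤ ∫⁻ x, ENNReal.ofReal (24 * (Real.exp (1 * x) + Real.exp (-1 * x)))
          ∂(gaussianReal 0 1) := lintegral_mono fun x => ENNReal.ofReal_le_ofReal (hb x)
    _ = ENNReal.ofReal (∫ x, 24 * (Real.exp (1 * x) + Real.exp (-1 * x)) ∂(gaussianReal 0 1)) :=
        (ofReal_integral_eq_lintegral_ofReal (((hi 1).add (hi (-1))).const_mul 24)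
          (Filter.Eventually.of_forall fun x =>
            mul_nonneg (by norm_num) (add_nonneg (Real.exp_pos _).le (Real.exp_pos _).le))).symm
    _ ≤ ENNReal.ofReal 80 := by
        refine ENNReal.ofReal_le_ofReal ?_
        rw [integral_const_mul, integral_add (hi 1) (hi (-1)), hm, hm]
        have : Real.exp (1 / 2) ≤ 5 / 3 := by
          have h := Real.exp_one_lt_d9
          have h2 : Real.exp (1 / 2) ^ 2 = Real.exp 1 := by
            rw [← Real.exp_nat_mul]
            norm_num
          have := Real.exp_pos (1 / 2)
          nlinarith
        norm_num at this ⊢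
        linarith

end Coupling

/-! ### The mean of the signed measurement vector. -/

section Bias

variable {Ω E : Type*} [MeasurableSpace Ω] {P : Measure Ω} [NormedAddCommGroup E]
  [InnerProductSpace ℝ E]

lemma sgn_mul_self (t : ℝ) : sgn t * t = |t| := by
  unfold sgn
  split_ifs with h
  · rw [abs_of_nonneg h, one_mul]
  · rw [abs_of_neg (not_le.1 h), neg_one_mul]

lemma sgn_eq_one_or (t : ℝ) : sgn t = 1 ∨ sgn t = -1 := by
  unfold sgn
  split_ifs <;> simp

lemma abs_sgn (t : ℝ) : |sgn t| = 1 := by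
  rcases sgn_eq_one_or t with h | h <;> simp [h]

lemma sgn_mul_le_abs (s t : ℝ) : sgn s * t ≤ |t| :=
  (le_abs_self _).trans (by rw [abs_mul, abs_sgn, one_mul])

lemma measurable_sgn : Measurable sgn :=
  Measurable.ite measurableSet_Ici measurable_const measurable_const

/-- If the first absolute moments of the linear forms of `X` are proportional to the norm up to a
relative error `δ`, then the signed means of `X` are controlled up to an error `√δ`. -/
lemma integral_sgn_mul_inner_le {X : Ω → E} [MeasurableSpace E] [BorelSpace E]
    [SecondCountableTopology E] (hX : Integrable X P) (hXm : Measurable X) {L δ : ℝ}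
    (hL : 0 ≤ L) (hδ : 0 < δ) (hδ1 : δ ≤ 1)
    (h : ∀ y : E, |(∫ ω, |inner ℝ (X ω) y| ∂P) - L * ‖y‖| ≤ δ * ‖y‖) {x x' : E} (hx : ‖x‖ = 1)
    (hx' : ‖x'‖ ≤ 1) :
    ∫ ω, sgn (inner ℝ (X ω) x) * inner ℝ (X ω) (x' - x) ∂P
      ≤ (2 * L + 4) * √δ - L / 2 * ‖x - x'‖ ^ 2 := by
  set z := x' - x with hz
  set s := √δ with hs
  have hs0 : 0 < s := Real.sqrt_pos.2 hδ
  have hss : s ^ 2 = δ := Real.sq_sqrt hδ.le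
  have hs1 : s ≤ 1 := Real.sqrt_le_one.2 hδ1
  have hzn : ‖z‖ ≤ 2 := by
    rw [hz]
    exact (norm_sub_le _ _).trans (by linarith)
  have hin : ∀ y : E, Integrable (fun ω => inner ℝ (X ω) y) P := fun y => hX.inner_const y
  have hsm : Measurable fun ω => sgn (inner ℝ (X ω) x) :=
    measurable_sgn.comp (by fun_prop)
  have hsi : Integrable (fun ω => sgn (inner ℝ (X ω) x) * inner ℝ (X ω) z) P := by
    refine (hin z).abs.mono' (by fun_prop) (Filter.Eventually.of_forall fun ω => ?_)
    rw [Real.norm_eq_abs, abs_mul, abs_sgn, one_mul]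
  set b := ∫ ω, sgn (inner ℝ (X ω) x) * inner ℝ (X ω) z ∂P with hb
  -- The subgradient inequality |u| + s sgn(u) v ≤ |u + s v|, integrated.
  have hsub : (∫ ω, |inner ℝ (X ω) x| ∂P) + s * b ≤ ∫ ω, |inner ℝ (X ω) (x + s • z)| ∂P := by
    rw [hb, ← integral_const_mul, ← integral_add (hin x).abs (hsi.const_mul s)]
    refine integral_mono ((hin x).abs.add (hsi.const_mul s)) (hin _).abs fun ω => ?_
    refine le_trans (le_of_eq ?_) (sgn_mul_le_abs (inner ℝ (X ω) x) _)
    rw [inner_add_right, real_inner_smul_right, mul_add, sgn_mul_self]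
    ring
  have h1 := (abs_le.1 (h x)).1
  have h2 := (abs_le.1 (h (x + s • z))).2
  rw [hx] at h1
  have hsq : ‖x + s • z‖ ^ 2 = 1 + 2 * (s * inner ℝ x z) + s ^ 2 * ‖z‖ ^ 2 := by
    rw [norm_add_sq_real, hx, real_inner_smul_right, norm_smul, mul_pow, Real.norm_eq_abs, sq_abs]
    ring
  -- From 2‖v‖ ≤ 1 + ‖v‖²: the norm is linear in s at the unit vector x up to a quadratic error.
  have hn : ‖x + s • z‖ ≤ 1 + s * inner ℝ x z + s ^ 2 * ‖z‖ ^ 2 / 2 := by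
    nlinarith [sq_nonneg (‖x + s • z‖ - 1)]
  have hn2 : ‖x + s • z‖ ≤ 1 + s * 2 := by
    refine (norm_add_le _ _).trans ?_
    rw [hx, norm_smul, Real.norm_of_nonneg hs0.le]
    gcongr
  -- Uses ‖x'‖ ≤ 1 = ‖x‖; this is where the squared distance appears.
  have hxz : inner ℝ x z ≤ -(1 / 2) * ‖x - x'‖ ^ 2 := by
    have e := norm_sub_sq_real x x'
    rw [hx] at e
    rw [hz, inner_sub_right, real_inner_self_eq_norm_sq, hx]
    nlinarith [norm_nonneg x']
  have hz4 : ‖z‖ ^ 2 ≤ 4 := by nlinarith [norm_nonneg z]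
  -- After division by s the errors are of order s and δ/s, which the choice s = √δ balances.
  have key : s * b ≤ s * (L * inner ℝ x z + (2 * L + 4) * s) := by
    have h3 : s * b ≤ L * (‖x + s • z‖ - 1) + δ * (‖x + s • z‖ + 1) := by linarith
    have h4 : L * (‖x + s • z‖ - 1) ≤ L * (s * inner ℝ x z + s ^ 2 * 4 / 2) := by
      refine mul_le_mul_of_nonneg_left ?_ hL
      have : s ^ 2 * ‖z‖ ^ 2 ≤ s ^ 2 * 4 := by gcongr
      linarith
    have h5 : δ * (‖x + s • z‖ + 1) ≤ s ^ 2 * 4 := by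
      rw [hss]
      refine mul_le_mul_of_nonneg_left ?_ hδ.le
      linarith
    linarith
  have h6 := le_of_mul_le_mul_left key hs0
  have h7 := mul_le_mul_of_nonneg_left hxz hL
  linarith

end Bias

/-! ### Moments controlled by the sub-gaussian norm. -/

section SubgaussianNorm

variable {Ω : Type*} [MeasurableSpace Ω] {P : Measure Ω} {X : Ω → ℝ}

lemma eLpNorm_le_of_subgaussianNorm (h : subgaussianNorm X P ≠ ∞) {q : ℝ} (hq : 1 ≤ q) :
    eLpNorm X (ENNReal.ofReal q) P ≤ ENNReal.ofReal ((subgaussianNorm X P).toReal * √q) := by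
  have hq0 : 0 < q := by linarith
  have h1 : ENNReal.ofReal (q ^ (-(1 / 2) : ℝ)) * eLpNorm X (ENNReal.ofReal q) P
      ≤ subgaussianNorm X P :=
    le_iSup₂ (f := fun (q : ℝ) (_ : 1 ≤ q) =>
      ENNReal.ofReal (q ^ (-(1 / 2) : ℝ)) * eLpNorm X (ENNReal.ofReal q) P) q hq
  have h2 : ENNReal.ofReal (√q) * ENNReal.ofReal (q ^ (-(1 / 2) : ℝ)) = 1 := by
    rw [← ENNReal.ofReal_mul (Real.sqrt_nonneg _), Real.sqrt_eq_rpow, ← Real.rpow_add hq0]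
    norm_num
  calc eLpNorm X (ENNReal.ofReal q) P
      = ENNReal.ofReal (√q) * (ENNReal.ofReal (q ^ (-(1 / 2) : ℝ))
          * eLpNorm X (ENNReal.ofReal q) P) := by rw [← mul_assoc, h2, one_mul]
    _ ≤ ENNReal.ofReal (√q) * subgaussianNorm X P := by gcongr
    _ = _ := by
        rw [mul_comm (subgaussianNorm X P).toReal, ENNReal.ofReal_mul (Real.sqrt_nonneg _),
          ENNReal.ofReal_toReal h]

lemma memLp_of_subgaussianNorm (hX : Measurable X) (h : subgaussianNorm X P ≠ ∞) {q : ℝ}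
    (hq : 1 ≤ q) : MemLp X (ENNReal.ofReal q) P :=
  ⟨hX.aestronglyMeasurable, (eLpNorm_le_of_subgaussianNorm h hq).trans_lt ENNReal.ofReal_lt_top⟩

lemma integrable_of_subgaussianNorm (hX : Measurable X) (h : subgaussianNorm X P ≠ ∞) :
    Integrable X P := by
  have := memLp_of_subgaussianNorm hX h le_rfl
  rw [ENNReal.ofReal_one] at this
  exact memLp_one_iff_integrable.1 this

lemma lintegral_pow_le_of_subgaussianNorm (h : subgaussianNorm X P ≠ ∞) {k : ℕ} (hk : 1 ≤ k)
    (hke : Even k) :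
    ∫⁻ ω, ENNReal.ofReal (X ω ^ k) ∂P
      ≤ ENNReal.ofReal (((subgaussianNorm X P).toReal * √(k : ℝ)) ^ k) := by
  have hk0 : (0 : ℝ) < k := by exact_mod_cast hk
  have h1 := eLpNorm_le_of_subgaussianNorm h (q := (k : ℝ)) (by exact_mod_cast hk)
  rw [eLpNorm_eq_lintegral_rpow_enorm_toReal (ENNReal.ofReal_pos.2 hk0).ne'
    ENNReal.ofReal_ne_top, ENNReal.toReal_ofReal hk0.le, one_div,
    ENNReal.rpow_inv_le_iff hk0, ENNReal.rpow_natCast, ← ENNReal.ofReal_pow (by positivity)] at h1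
  refine le_trans (le_of_eq (lintegral_congr fun ω => ?_)) h1
  rw [ENNReal.rpow_natCast, Real.enorm_eq_ofReal_abs, ← ENNReal.ofReal_pow (abs_nonneg _),
    hke.pow_abs]

/-- The exponent q = 2 in the supremum. This lower bound on κ lets absolute constants, such as the
Gaussian fourth moment, be absorbed into powers of κ. -/
lemma one_le_two_mul_sq_subgaussianNorm [IsProbabilityMeasure P] (hX : Measurable X)
    (h : subgaussianNorm X P ≠ ∞) (hv : Var[X; P] = 1) :
    1 ≤ 2 * (subgaussianNorm X P).toReal ^ 2 := by
  have h1 := variance_le_expectation_sq (μ := P) hX.aestronglyMeasurable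
  have h2 := lintegral_pow_le_of_subgaussianNorm h one_le_two even_two
  simp only [Pi.pow_apply] at h1
  rw [hv, integral_eq_lintegral_of_nonneg_ae (Filter.Eventually.of_forall fun ω => sq_nonneg _)
    (by fun_prop)] at h1
  have h3 := ENNReal.toReal_le_of_le_ofReal (by positivity) h2
  rw [mul_pow, Real.sq_sqrt (by positivity)] at h3
  push_cast at h3
  linarith

lemma subgaussianNorm_toReal_pos [IsProbabilityMeasure P] (hX : Measurable X)
    (h : subgaussianNorm X P ≠ ∞) (hv : Var[X; P] = 1) : 0 < (subgaussianNorm X P).toReal := by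
  have h1 := one_le_two_mul_sq_subgaussianNorm hX h hv
  rcases (ENNReal.toReal_nonneg : 0 ≤ (subgaussianNorm X P).toReal).eq_or_lt with h2 | h2
  · rw [← h2] at h1
    norm_num at h1
  · exact h2

end SubgaussianNorm

lemma abs_sub_le_tvDist {α : Type*} [MeasurableSpace α] (μ ν : Measure α) [IsProbabilityMeasure μ]
    [IsProbabilityMeasure ν] {A : Set α} (hA : MeasurableSet A) :
    |μ.real A - ν.real A| ≤ tvDist μ ν := by
  refine le_ciSup (f := fun A : {A : Set α // MeasurableSet A} => |μ.real A - ν.real A|)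
    ⟨1, ?_⟩ ⟨A, hA⟩
  rintro _ ⟨B, rfl⟩
  have h1 : μ.real (B : Set α) ≤ 1 := measureReal_le_one
  have h2 : ν.real (B : Set α) ≤ 1 := measureReal_le_one
  have h3 : 0 ≤ μ.real (B : Set α) := measureReal_nonneg
  have h4 : 0 ≤ ν.real (B : Set α) := measureReal_nonneg
  exact abs_le.2 ⟨by linarith, by linarith⟩

/-! ### Vectors with i.i.d. coordinates. -/

section IID

variable {Ω : Type*} [MeasurableSpace Ω] {P : Measure Ω} [IsProbabilityMeasure P]

/-- If two families are each independent, and independent of each other, then the family of pairs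
is independent. -/
lemma iIndepFun_prodMk {ι α β : Type*} [Fintype ι] [MeasurableSpace α] [MeasurableSpace β]
    {X : ι → Ω → α} {Y : ι → Ω → β} (hX : ∀ i, Measurable (X i)) (hY : ∀ i, Measurable (Y i))
    (hiX : iIndepFun X P) (hiY : iIndepFun Y P)
    (hXY : IndepFun (fun ω i => X i ω) (fun ω i => Y i ω) P) :
    iIndepFun (fun i ω => (X i ω, Y i ω)) P := by
  have hpX : ∀ i, IsProbabilityMeasure (P.map (X i)) := fun i =>
    Measure.isProbabilityMeasure_map (hX i).aemeasurable
  have hpY : ∀ i, IsProbabilityMeasure (P.map (Y i)) := fun i =>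
    Measure.isProbabilityMeasure_map (hY i).aemeasurable
  have hmX : Measurable fun ω i => X i ω := measurable_pi_lambda _ hX
  have hmY : Measurable fun ω i => Y i ω := measurable_pi_lambda _ hY
  rw [iIndepFun_iff_map_fun_eq_pi_map fun i => ((hX i).prodMk (hY i)).aemeasurable]
  have h1 : ∀ i, P.map (fun ω => (X i ω, Y i ω)) = (P.map (X i)).prod (P.map (Y i)) := fun i =>
    (indepFun_iff_map_prod_eq_prod_map_map (hX i).aemeasurable (hY i).aemeasurable).1
      (hXY.comp (measurable_pi_apply i) (measurable_pi_apply i))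
  have h2 := (indepFun_iff_map_prod_eq_prod_map_map hmX.aemeasurable hmY.aemeasurable).1 hXY
  rw [(iIndepFun_iff_map_fun_eq_pi_map fun i => (hX i).aemeasurable).1 hiX,
    (iIndepFun_iff_map_fun_eq_pi_map fun i => (hY i).aemeasurable).1 hiY] at h2
  have h3 := (measurePreserving_arrowProdEquivProdArrow α β ι (fun i => P.map (X i))
    (fun i => P.map (Y i))).symm
  simp only [h1]
  rw [← h3.map_eq, ← h2, Measure.map_map h3.measurable (hmX.prodMk hmY)]
  rfl

variable {n : ℕ} {X : Ω → EuclideanSpace ℝ (Fin n)} {μ : Measure ℝ}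

lemma map_ofLp_eq_pi (hX : Measurable X) (hi : iIndepFun (fun j ω => X ω j) P)
    (hμ : ∀ j, P.map (fun ω => X ω j) = μ) :
    P.map (fun ω => (X ω).ofLp) = Measure.pi fun _ : Fin n => μ := by
  have := (iIndepFun_iff_map_fun_eq_pi_map fun j => (by fun_prop :
    AEMeasurable (fun ω => X ω j) P)).1 hi
  simp only [hμ] at this
  exact this

lemma map_neg_eq_of_coord [IsProbabilityMeasure μ] (hX : Measurable X)
    (hi : iIndepFun (fun j ω => X ω j) P)
    (hμ : ∀ j, P.map (fun ω => X ω j) = μ) (hsym : μ.map (fun x => -x) = μ) :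
    (P.map X).map (fun x => -x) = P.map X := by
  have h1 := map_ofLp_eq_pi hX hi hμ
  have hm1 : Measurable fun ω => (X ω).ofLp := by fun_prop
  have h2 : P.map X = (Measure.pi fun _ : Fin n => μ).map (WithLp.toLp 2) := by
    rw [← h1, Measure.map_map (by fun_prop) hm1]
    rfl
  have h3 : (Measure.pi fun _ : Fin n => μ).map (fun s j => -s j)
      = Measure.pi fun _ : Fin n => μ := by
    have : SigmaFinite (μ.map fun x => -x) := by rw [hsym]; infer_instance
    rw [Measure.pi_map_pi (f := fun _ x => -x) fun _ => by fun_prop, hsym]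
  rw [h2, Measure.map_map (by fun_prop) (by fun_prop)]
  conv_rhs => rw [← h3, Measure.map_map (by fun_prop) (by fun_prop)]
  rfl

omit [IsProbabilityMeasure P] in
lemma integrable_of_coord (hX : Measurable X) (hμ : ∀ j, P.map (fun ω => X ω j) = μ)
    (hi : Integrable id μ) : Integrable X P := by
  have hj : ∀ j, Integrable (fun ω => X ω j) P := fun j => by
    have hm : Measurable fun ω => X ω j := by fun_prop
    exact (⟨hm, hμ j⟩ : MeasurePreserving _ P μ).integrable_comp_of_integrable hi
  have hs : X = fun ω => ∑ j, X ω j • EuclideanSpace.single j (1 : ℝ) := by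
    ext ω k
    simp [Pi.single_apply]
  rw [hs]
  exact integrable_finsetSum _ fun j _ => (hj j).smul_const _

lemma integral_abs_inner_eq (hX : Measurable X) (hi : iIndepFun (fun j ω => X ω j) P)
    (hμ : ∀ j, P.map (fun ω => X ω j) = μ) (y : EuclideanSpace ℝ (Fin n)) :
    ∫ ω, |inner ℝ (X ω) y| ∂P = ∫ s, |∑ j, s j * y j| ∂(Measure.pi fun _ : Fin n => μ) := by
  have hm : Measurable fun s : Fin n → ℝ => |∑ j, s j * y j| := by fun_prop
  rw [← map_ofLp_eq_pi hX hi hμ, integral_map (by fun_prop) hm.aestronglyMeasurable]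
  refine integral_congr_ae (Filter.Eventually.of_forall fun ω => ?_)
  simp [PiLp.inner_apply, mul_comm]

end IID

/-! ### Random sign flips. -/

section Flips

variable {Ω : Type*} [MeasurableSpace Ω] {P : Measure Ω} [IsProbabilityMeasure P] {e : Ω → ℝ}
  {p : ℝ}

lemma ae_flip_eq (he : Measurable e) (h1 : P.real {ω | e ω = 1} = 1 - p)
    (h2 : P.real {ω | e ω = -1} = p) : ∀ᵐ ω ∂P, e ω = 1 ∨ e ω = -1 := by
  have hm1 : MeasurableSet {ω | e ω = 1} := he (measurableSet_singleton 1)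
  have hm2 : MeasurableSet {ω | e ω = -1} := he (measurableSet_singleton (-1))
  have hd : Disjoint {ω | e ω = 1} {ω | e ω = -1} := by
    rw [Set.disjoint_left]
    intro ω h h'
    simp only [Set.mem_ofPred_eq] at h h'
    linarith
  have h3 : P.real ({ω | e ω = 1} ∪ {ω | e ω = -1}) = 1 := by
    rw [measureReal_union hd hm2, h1, h2]
    ring
  rw [ae_iff, ← measureReal_eq_zero_iff]
  have h4 := probReal_compl_eq_one_sub (μ := P) (hm1.union hm2)
  rw [h3, sub_self] at h4
  exact h4

lemma integral_flip_eq (he : Measurable e) (h1 : P.real {ω | e ω = 1} = 1 - p)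
    (h2 : P.real {ω | e ω = -1} = p) : ∫ ω, e ω ∂P = 1 - 2 * p := by
  have hm1 : MeasurableSet {ω | e ω = 1} := he (measurableSet_singleton 1)
  have hm2 : MeasurableSet {ω | e ω = -1} := he (measurableSet_singleton (-1))
  have h : ∫ ω, e ω ∂P = ∫ ω, (Set.indicator {ω | e ω = 1} (fun _ => (1 : ℝ)) ω
      - Set.indicator {ω | e ω = -1} (fun _ => (1 : ℝ)) ω) ∂P := by
    refine integral_congr_ae ?_
    filter_upwards [ae_flip_eq he h1 h2] with ω hω
    rcases hω with h | h <;> norm_num [Set.indicator, h]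
  rw [h, integral_sub ((integrable_const _).indicator hm1) ((integrable_const _).indicator hm2),
    integral_indicator hm1, integral_indicator hm2]
  simp only [setIntegral_const, smul_eq_mul, mul_one, h1, h2]
  ring

end Flips

/-! ### Tail bound for the centred sum. -/

section Deviation

variable {Ω : Type*} [MeasurableSpace Ω] {P : Measure Ω} [IsProbabilityMeasure P]

omit [IsProbabilityMeasure P] in
/-- Tail bound for the support function of a random vector that is dominated by a Gaussian vector
in the convex order. -/
lemma measure_lt_supportFn_le {E : Type*} [NormedAddCommGroup E] [InnerProductSpace ℝ E]
    [FiniteDimensional ℝ E] [MeasurableSpace E] [BorelSpace E] {T : Set E} {R : ℝ}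
    (hT : T ⊆ Metric.closedBall 0 R) (h0 : (0 : E) ∈ T) {V : Ω → E} (hV : Measurable V) {c : ℝ}
    (hc : 0 < c) (hdom : ConvexDominated (P.map V) ((stdGaussian E).map fun g => c • g)) {β : ℝ}
    (hβ : 0 < β) :
    P.real {ω | c * (2 * (∫ g, supportFn T g ∂(stdGaussian E)) + (9 / 4 * R ^ 2 + 1) * β)
      < supportFn T (V ω)} ≤ Real.exp (-β ^ 2) := by
  set w := ∫ g, supportFn T g ∂(stdGaussian E) with hw
  set r := c * (2 * w + (9 / 4 * R ^ 2 + 1) * β) with hr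
  have hk := continuous_supportFn hT h0
  -- With this t the dilation c cancels, and the exponent 2βw + (9/4)β²R² - t r equals -β²; the
  -- summand 1 in the threshold supplies it.
  set t := β / c with ht
  have ht0 : 0 < t := by positivity
  have htc : t * c = β := by rw [ht]; field_simp
  have hm : Measurable fun v : E => ENNReal.ofReal (Real.exp (t * supportFn T v)) := by fun_prop
  have h1 : ∫⁻ ω, ENNReal.ofReal (Real.exp (t * supportFn T (V ω))) ∂P
      ≤ ENNReal.ofReal (Real.exp (2 * β * w + 9 / 4 * β ^ 2 * R ^ 2)) := by
    have hconv : ConvexOn ℝ Set.univ fun v => Real.exp (t * supportFn T v) := by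
      refine ⟨convex_univ, fun x hx y hy a b ha hb hab => ?_⟩
      have h3 := ((convexOn_supportFn hT h0).smul ht0.le).2 hx hy ha hb hab
      exact (Real.exp_le_exp.2 h3).trans
        (convexOn_exp.2 (Set.mem_univ _) (Set.mem_univ _) ha hb hab)
    have h := hdom _ hconv (by fun_prop) fun v => (Real.exp_pos _).le
    rw [lintegral_map hm hV, lintegral_map hm (by fun_prop)] at h
    refine h.trans (le_trans (le_of_eq (lintegral_congr fun g => ?_))
      (lintegral_exp_supportFn_le hT h0 hβ.le))
    rw [supportFn_smul T hc.le, ← mul_assoc, htc]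
  have h2 : P {ω | r < supportFn T (V ω)} ≤ ENNReal.ofReal (Real.exp (-β ^ 2)) := by
    have h3 := meas_ge_le_lintegral_div (μ := P)
      (f := fun ω => ENNReal.ofReal (Real.exp (t * supportFn T (V ω)))) (hm.comp hV).aemeasurable
      (ε := ENNReal.ofReal (Real.exp (t * r))) (ENNReal.ofReal_pos.2 (Real.exp_pos _)).ne'
      ENNReal.ofReal_ne_top
    refine (measure_mono fun ω hω => ?_).trans (h3.trans ?_)
    · exact ENNReal.ofReal_le_ofReal (Real.exp_le_exp.2
        (mul_le_mul_of_nonneg_left (le_of_lt hω) ht0.le))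
    · refine (ENNReal.div_le_div_right h1 _).trans (le_of_eq ?_)
      rw [← ENNReal.ofReal_div_of_pos (Real.exp_pos _), ← Real.exp_sub]
      congr 2
      rw [hr, ← mul_assoc, htc]
      ring
  exact ENNReal.toReal_le_of_le_ofReal (Real.exp_pos _).le h2

end Deviation

lemma integral_eq_zero_of_map_neg {μ : Measure ℝ} (h : μ.map (fun x => -x) = μ) :
    ∫ x, x ∂μ = 0 := by
  have h1 : ∫ x, x ∂μ = ∫ x, -x ∂μ := by
    conv_lhs => rw [← h]
    rw [integral_map (by fun_prop) (by fun_prop)]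
  rw [integral_neg] at h1
  linarith

/-- For a random vector whose i.i.d. coordinates are distributed as a symmetric sub-gaussian
variable close to `N(0,1)`, the first absolute moments of linear forms are nearly Gaussian. -/
lemma abs_integral_abs_inner_sub_le {Ω₀ Ω : Type*} [MeasurableSpace Ω₀] {P₀ : Measure Ω₀}
    [IsProbabilityMeasure P₀] {a₀ : Ω₀ → ℝ} (ha₀ : Measurable a₀)
    (hsym : (P₀.map a₀).map (fun x => -x) = P₀.map a₀) (hsub : subgaussianNorm a₀ P₀ ≠ ∞)
    (hvar : Var[a₀; P₀] = 1) {ε : ℝ} (hε : 0 < ε)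
    (htv : tvDist (P₀.map a₀) (gaussianReal 0 1) ≤ ε) [MeasurableSpace Ω] {P : Measure Ω}
    [IsProbabilityMeasure P] {n : ℕ} {X : Ω → EuclideanSpace ℝ (Fin n)} (hX : Measurable X)
    (hi : iIndepFun (fun j ω => X ω j) P) (hμ : ∀ j, P.map (fun ω => X ω j) = P₀.map a₀)
    (y : EuclideanSpace ℝ (Fin n)) :
    |(∫ ω, |inner ℝ (X ω) y| ∂P) - gaussianAbsMoment * ‖y‖|
      ≤ 10 * (subgaussianNorm a₀ P₀).toReal * √√ε * ‖y‖ := by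
  set κ := (subgaussianNorm a₀ P₀).toReal with hκ
  have hκ2 : 1 ≤ 2 * κ ^ 2 := one_le_two_mul_sq_subgaussianNorm ha₀ hsub hvar
  have hκpos : 0 < κ := subgaussianNorm_toReal_pos ha₀ hsub hvar
  have hpμ : IsProbabilityMeasure (P₀.map a₀) :=
    Measure.isProbabilityMeasure_map ha₀.aemeasurable
  have hκ4 : 1 ≤ 4 * κ ^ 4 := by nlinarith
  -- The radius 5κ serves both laws: a₀ has fourth moment at most (2κ)⁴, and 4κ⁴ ≥ 1 puts (5κ)⁴
  -- above 80.
  have h4 : ∫⁻ x, ENNReal.ofReal (x ^ 4) ∂(P₀.map a₀) ≤ ENNReal.ofReal ((5 * κ) ^ 4) := by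
    rw [lintegral_map (by fun_prop) ha₀]
    refine (lintegral_pow_le_of_subgaussianNorm hsub (by norm_num) (by decide)).trans
      (ENNReal.ofReal_le_ofReal ?_)
    have : √((4 : ℕ) : ℝ) = 2 := by
      rw [show ((4 : ℕ) : ℝ) = 2 ^ 2 by norm_num, Real.sqrt_sq (by norm_num)]
    rw [this, ← hκ]
    exact pow_le_pow_left₀ (by positivity) (by linarith) 4
  have h4' : ∫⁻ x, ENNReal.ofReal (x ^ 4) ∂(gaussianReal 0 1) ≤ ENNReal.ofReal ((5 * κ) ^ 4) :=
    lintegral_pow_four_gaussianReal_le.trans (ENNReal.ofReal_le_ofReal (by nlinarith))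
  obtain ⟨π, hπ1, hπ2, hπ⟩ := exists_coupling_sq_le hε (by positivity : 0 < 5 * κ)
    (fun A hA => (abs_sub_le_tvDist _ _ hA).trans htv) h4 h4'
  have hD : (10 * κ * √√ε) ^ 2 = 4 * (5 * κ) ^ 2 * √ε := by
    rw [mul_pow, Real.sq_sqrt (Real.sqrt_nonneg _)]
    ring
  rw [← hD] at hπ
  have hint : Integrable id (P₀.map a₀) :=
    (integrable_map_measure (by fun_prop) ha₀.aemeasurable).2
      (integrable_of_subgaussianNorm ha₀ hsub)
  rw [integral_abs_inner_eq hX hi hμ, ← integral_abs_sum_gaussianReal]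
  exact abs_integral_abs_sum_sub_le hπ1 hπ2 hint IsGaussian.integrable_id
    (integral_eq_zero_of_map_neg hsym) (integral_eq_zero_of_map_neg gaussianReal_map_neg_zero)
    (by positivity) hπ y

lemma sub_self_subset_closedBall {E : Type*} [SeminormedAddCommGroup E] {K : Set E}
    (hK : K ⊆ Metric.closedBall 0 1) : K - K ⊆ Metric.closedBall 0 2 := by
  rintro _ ⟨u, hu, w, hw, rfl⟩
  have h1 := hK hu
  have h2 := hK hw
  rw [mem_closedBall_zero_iff] at h1 h2 ⊢
  exact (norm_sub_le _ _).trans (by linarith)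

/-! ### Combining bias and deviation. -/

section Recovery

variable {Ω₀ Ω : Type*} [MeasurableSpace Ω₀] {P₀ : Measure Ω₀} [IsProbabilityMeasure P₀]
  {a₀ : Ω₀ → ℝ} [MeasurableSpace Ω] {P : Measure Ω} [IsProbabilityMeasure P] {n : ℕ}

/-- The signed vector `f sgn⟨X, x⟩ X` is, after centring, dominated by a Gaussian vector. -/
lemma convexDominated_signed (ha₀ : Measurable a₀)
    (hsym : (P₀.map a₀).map (fun x => -x) = P₀.map a₀) (hsub : subgaussianNorm a₀ P₀ ≠ ∞)
    (hκ : 0 < (subgaussianNorm a₀ P₀).toReal)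
    {X : Ω → EuclideanSpace ℝ (Fin n)} (hX : Measurable X)
    (hi : iIndepFun (fun j ω => X ω j) P) (hμ : ∀ j, P.map (fun ω => X ω j) = P₀.map a₀)
    {Y : Ω → EuclideanSpace ℝ (Fin n)} (hY : Measurable Y) (hYi : Integrable Y P)
    (hs : ∀ᵐ ω ∂P, Y ω = X ω ∨ Y ω = -X ω) :
    ConvexDominated (P.map fun ω => Y ω - ∫ ω', Y ω' ∂P)
      ((stdGaussian (EuclideanSpace ℝ (Fin n))).map
        fun g => (2 * (dominationConst * (subgaussianNorm a₀ P₀).toReal)) • g) := by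
  have hpμ : IsProbabilityMeasure (P₀.map a₀) :=
    Measure.isProbabilityMeasure_map ha₀.aemeasurable
  have h1 := ConvexDominated.map_sub_integral hX hY hYi hs (map_neg_eq_of_coord hX hi hμ hsym)
  have h2 : ConvexDominated (P.map X) _ := convexDominated_stdGaussian_of_coord hX hi
    (c := dominationConst * (subgaussianNorm a₀ P₀).toReal) fun j => by
      rw [hμ j]
      exact convexDominated_gaussianReal ha₀ hsym hκ fun q hq =>
        eLpNorm_le_of_subgaussianNorm hsub hq
  have h3 := h2.map ((2 : ℝ) • ContinuousLinearMap.id ℝ (EuclideanSpace ℝ (Fin n)))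
  rw [Measure.map_map (ContinuousLinearMap.continuous _).measurable hX,
    Measure.map_map (ContinuousLinearMap.continuous _).measurable (by fun_prop)] at h3
  refine h1.trans ?_
  convert h3 using 2
  · rfl
  · funext g
    simp [smul_smul]

/-- The deterministic part of the recovery estimate. -/
lemma sq_norm_sub_le_of_isSolution {m : ℕ} (hm : 0 < m) {K : Set (EuclideanSpace ℝ (Fin n))}
    (hK : K ⊆ Metric.closedBall 0 1) {x x' : EuclideanSpace ℝ (Fin n)} (hxK : x ∈ K)
    {a : Fin m → EuclideanSpace ℝ (Fin n)} {e : Fin m → ℝ}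
    (hsol : IsSolution a (measurements a e x) K x') {p : ℝ} (hp : p < 1 / 2)
    {v : Fin m → EuclideanSpace ℝ (Fin n)} {r L b : ℝ} (hL : 0 < L)
    (hr : supportFn (K - K) (∑ i, ((e i * sgn (inner ℝ (a i) x)) • a i - v i)) ≤ r)
    (hv : ∀ i, inner ℝ (v i) (x' - x) ≤ (1 - 2 * p) * (b - L / 2 * ‖x - x'‖ ^ 2)) :
    ‖x - x'‖ ^ 2 ≤ 2 / L * (b + r / ((1 - 2 * p) * m)) := by
  have hT : K - K ⊆ Metric.closedBall (0 : EuclideanSpace ℝ (Fin n)) 2 :=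
    sub_self_subset_closedBall hK
  have hopt : ∑ i, measurements a e x i * inner ℝ (a i) x
      ≤ ∑ i, measurements a e x i * inner ℝ (a i) x' := hsol.2 hxK
  have hz : x' - x ∈ K - K := Set.sub_mem_sub hsol.1 hxK
  have h1 := (inner_le_supportFn hT _ hz).trans hr
  have h2 : inner ℝ (∑ i, ((e i * sgn (inner ℝ (a i) x)) • a i - v i)) (x' - x)
      = (∑ i, measurements a e x i * inner ℝ (a i) x'
        - ∑ i, measurements a e x i * inner ℝ (a i) x) - ∑ i, inner ℝ (v i) (x' - x) := by
    rw [sum_inner, ← Finset.sum_sub_distrib, ← Finset.sum_sub_distrib]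
    refine Finset.sum_congr rfl fun i _ => ?_
    rw [inner_sub_left, real_inner_smul_left, inner_sub_right (a i), measurements]
    ring
  have h3 : ∑ i, inner ℝ (v i) (x' - x) ≤ m * ((1 - 2 * p) * (b - L / 2 * ‖x - x'‖ ^ 2)) := by
    refine (Finset.sum_le_sum fun i _ => hv i).trans (le_of_eq ?_)
    simp
  have hmp : (0 : ℝ) < m := by exact_mod_cast hm
  have hq : 0 < 1 - 2 * p := by linarith
  -- Optimality of x' against x makes the uncentred sum nonnegative; it is the centred part, at most
  -- r, plus the mean part.
  have h4 : 0 ≤ r + (1 - 2 * p) * m * (b - L / 2 * ‖x - x'‖ ^ 2) := by linarith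
  have h5 : L / 2 * ‖x - x'‖ ^ 2 ≤ b + r / ((1 - 2 * p) * m) := by
    have : 0 ≤ (r + (1 - 2 * p) * m * (b - L / 2 * ‖x - x'‖ ^ 2)) / ((1 - 2 * p) * m) := by
      positivity
    rw [add_div, mul_div_cancel_left₀ _ (by positivity)] at this
    linarith
  calc ‖x - x'‖ ^ 2 = 2 / L * (L / 2 * ‖x - x'‖ ^ 2) := by field_simp
    _ ≤ _ := by gcongr

/-- The absolute constant of the recovery theorem. -/
noncomputable def recoveryConst : ℝ :=
  (4 + 8 / gaussianAbsMoment) * √10 + 40 * dominationConst / gaussianAbsMoment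

lemma sqrt_mul_sqrt_sqrt {κ ε : ℝ} (hκ : 0 ≤ κ) (hε : 0 ≤ ε) :
    √(10 * κ * √√ε) = √10 * √κ * ε ^ (1 / 8 : ℝ) := by
  rw [Real.sqrt_mul (by positivity), Real.sqrt_mul (by norm_num)]
  congr 1
  rw [Real.sqrt_eq_rpow, Real.sqrt_eq_rpow, Real.sqrt_eq_rpow, ← Real.rpow_mul hε,
    ← Real.rpow_mul hε]
  norm_num

end Recovery

end OneBitCS

/-! ### The recovery theorem. -/

open OneBitCS in
theorem mainTheorem4 :
    ∃ C : ℝ, 0 < C ∧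
      ∀ (Ω₀ : Type*) [MeasurableSpace Ω₀] (P₀ : Measure Ω₀) [IsProbabilityMeasure P₀]
        -- the coordinate variable: symmetric, sub-gaussian, of unit variance,
        -- and within `ε` of `N(0,1)` in total variation
        (a₀ : Ω₀ → ℝ) (_ : Measurable a₀)
        (_ : IdentDistrib a₀ (fun ω => -a₀ ω) P₀ P₀)
        (_ : OneBitCS.subgaussianNorm a₀ P₀ ≠ ∞)
        (_ : Var[a₀; P₀] = 1)
        (ε : ℝ) (_ : OneBitCS.tvDist (P₀.map a₀) (gaussianReal 0 1) ≤ ε)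
        (m n : ℕ) (_ : 0 < m)
        -- the signal set and the signal
        (K : Set (EuclideanSpace ℝ (Fin n))) (_ : K ⊆ Metric.closedBall 0 1)
        (x : EuclideanSpace ℝ (Fin n)) (_ : x ∈ K) (_ : ‖x‖ = 1)
        (Ω : Type*) [MeasurableSpace Ω] (P : Measure Ω) [IsProbabilityMeasure P]
        -- independent measurement vectors whose coordinates are i.i.d. copies of `a₀`
        (a : Fin m → Ω → EuclideanSpace ℝ (Fin n)) (_ : ∀ i, Measurable (a i))
        (_ : iIndepFun a P)
        (_ : ∀ i, iIndepFun (fun (j : Fin n) (ω : Ω) => a i ω j) P)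
        (_ : ∀ i j, IdentDistrib (fun ω => a i ω j) a₀ P P₀)
        -- i.i.d. random flips, independent of the measurement vectors
        (p : ℝ) (_ : 0 ≤ p) (_ : p < 1 / 2)
        (e : Fin m → Ω → ℝ) (_ : ∀ i, Measurable (e i))
        (_ : iIndepFun e P)
        (_ : ∀ i, P.real {ω | e i ω = 1} = 1 - p)
        (_ : ∀ i, P.real {ω | e i ω = -1} = p)
        (_ : IndepFun (fun ω i => a i ω) (fun ω i => e i ω) P)
        (β : ℝ) (_ : 0 < β),
        ∃ E : Set Ω, MeasurableSet E ∧ 1 - 4 * Real.exp (-β ^ 2) ≤ P.real E ∧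
          ∀ ω ∈ E, ∀ x' : EuclideanSpace ℝ (Fin n),
            OneBitCS.IsSolution (fun i => a i ω)
                (OneBitCS.measurements (fun i => a i ω) (fun i => e i ω) x) K x' →
              ‖x - x'‖ ^ 2 ≤
                C * √(OneBitCS.subgaussianNorm a₀ P₀).toReal * ε ^ (1 / 8 : ℝ) +
                  C * (OneBitCS.subgaussianNorm a₀ P₀).toReal / ((1 - 2 * p) * √(m : ℝ)) *
                    (OneBitCS.meanWidth K + β) := by
  have hL := gaussianAbsMoment_pos
  have hc0 := dominationConst_pos
  refine ⟨recoveryConst, by unfold recoveryConst; positivity, ?_⟩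
  intro Ω₀ _ P₀ _ a₀ ha₀ hid hsub hvar ε htv m n hm K hK x hxK hx Ω _ P _ a ha hia hic hμ' p hp0 hp
    e he hie hep hen hae β hβ
  have hsym : (P₀.map a₀).map (fun x => -x) = P₀.map a₀ := by
    rw [Measure.map_map (by fun_prop) ha₀]
    exact hid.map_eq.symm
  have hμ : ∀ i j, P.map (fun ω => a i ω j) = P₀.map a₀ := fun i j => (hμ' i j).map_eq
  have hpμ : IsProbabilityMeasure (P₀.map a₀) :=
    Measure.isProbabilityMeasure_map ha₀.aemeasurable
  set κ := (subgaussianNorm a₀ P₀).toReal with hκ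
  have hκpos : 0 < κ := subgaussianNorm_toReal_pos ha₀ hsub hvar
  have hint : Integrable id (P₀.map a₀) :=
    (integrable_map_measure (by fun_prop) ha₀.aemeasurable).2
      (integrable_of_subgaussianNorm ha₀ hsub)
  have hai : ∀ i, Integrable (a i) P := fun i => integrable_of_coord (ha i) (hμ i) hint
  have hT : K - K ⊆ Metric.closedBall (0 : EuclideanSpace ℝ (Fin n)) 2 :=
    sub_self_subset_closedBall hK
  have hT0 : (0 : EuclideanSpace ℝ (Fin n)) ∈ K - K := by
    simpa using Set.sub_mem_sub hxK hxK
  -- the signed measurement vectors and their centred sum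
  set f : EuclideanSpace ℝ (Fin n) × ℝ → EuclideanSpace ℝ (Fin n) :=
    fun q => (q.2 * sgn (inner ℝ q.1 x)) • q.1 with hf
  have hfm : Measurable f := by
    have : Measurable fun q : EuclideanSpace ℝ (Fin n) × ℝ => sgn (inner ℝ q.1 x) :=
      measurable_sgn.comp (by fun_prop)
    fun_prop
  set Y : Fin m → Ω → EuclideanSpace ℝ (Fin n) := fun i ω => f (a i ω, e i ω) with hY
  have hYm : ∀ i, Measurable (Y i) := fun i => hfm.comp ((ha i).prodMk (he i))
  have hYs : ∀ i, ∀ᵐ ω ∂P, Y i ω = a i ω ∨ Y i ω = -a i ω := fun i => by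
    filter_upwards [ae_flip_eq (he i) (hep i) (hen i)] with ω hω
    rcases hω with h | h <;> rcases sgn_eq_one_or (inner ℝ (a i ω) x) with h' | h' <;>
      simp [hY, hf, h, h']
  have hYi : ∀ i, Integrable (Y i) P := fun i => by
    refine (hai i).mono (hYm i).aestronglyMeasurable ?_
    filter_upwards [hYs i] with ω hω
    rcases hω with h | h <;> simp [h]
  have hYind : iIndepFun (fun i ω => Y i ω - ∫ ω', Y i ω' ∂P) P :=
    (iIndepFun_prodMk ha he hia hie hae).comp (fun i q => f q - ∫ ω', Y i ω' ∂P)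
      fun i => hfm.sub_const _
  set V : Ω → EuclideanSpace ℝ (Fin n) := fun ω => ∑ i, (Y i ω - ∫ ω', Y i ω' ∂P) with hV
  have hVm : Measurable V := Finset.measurable_sum _ fun i _ => (hYm i).sub_const _
  have hmp : (0 : ℝ) < m := by exact_mod_cast hm
  have hdom : ConvexDominated (P.map V) ((stdGaussian (EuclideanSpace ℝ (Fin n))).map
      fun g => (2 * (dominationConst * κ) * √m) • g) :=
    convexDominated_stdGaussian_sum (fun i => (hYm i).sub_const _) hYind fun i =>
      convexDominated_signed ha₀ hsym hsub hκpos (ha i) (hic i) (hμ i) (hYm i) (hYi i) (hYs i)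
  -- K - K lies in the ball of radius 2, so the coefficient of β is 9/4 · 2² + 1 = 10.
  set r := 2 * (dominationConst * κ) * √m * (2 * meanWidth K + (9 / 4 * 2 ^ 2 + 1) * β) with hr
  have htail : P.real {ω | r < supportFn (K - K) (V ω)} ≤ Real.exp (-β ^ 2) :=
    measure_lt_supportFn_le hT hT0 hVm (by positivity) hdom hβ
  have hEm : MeasurableSet {ω | r < supportFn (K - K) (V ω)} :=
    measurableSet_lt measurable_const ((continuous_supportFn hT hT0).measurable.comp hVm)
  refine ⟨{ω | r < supportFn (K - K) (V ω)}ᶜ, hEm.compl, ?_, ?_⟩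
  -- There is a single exceptional event, of probability at most exp(-β²), so the factor 4 is slack.
  · rw [probReal_compl_eq_one_sub hEm]
    have := Real.exp_pos (-β ^ 2)
    linarith
  intro ω hω x' hsol
  have hrω : supportFn (K - K) (V ω) ≤ r := not_lt.1 hω
  have hw : 0 ≤ meanWidth K := integral_nonneg fun g => supportFn_nonneg hT hT0 g
  have hq : 0 < 1 - 2 * p := by linarith
  have hx'1 : ‖x'‖ ≤ 1 := by simpa using hK hsol.1
  have hε0 : 0 ≤ ε := by
    have := (abs_sub_le_tvDist (P₀.map a₀) (gaussianReal 0 1) MeasurableSet.empty).trans htv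
    simpa using this
  have hsecond : 2 / gaussianAbsMoment * (r / ((1 - 2 * p) * m))
      ≤ recoveryConst * κ / ((1 - 2 * p) * √m) * (meanWidth K + β) := by
    have hsm : √(m : ℝ) * √m = m := Real.mul_self_sqrt hmp.le
    have hsm0 : 0 < √(m : ℝ) := Real.sqrt_pos.2 hmp
    have e1 : 2 / gaussianAbsMoment * (r / ((1 - 2 * p) * m))
        = 4 * dominationConst / gaussianAbsMoment * κ / ((1 - 2 * p) * √m)
          * (2 * meanWidth K + 10 * β) := by
      rw [hr]
      nth_rewrite 2 [← hsm]
      field_simp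
      ring
    have e2 : 40 * dominationConst / gaussianAbsMoment ≤ recoveryConst := by
      unfold recoveryConst
      have : 0 ≤ (4 + 8 / gaussianAbsMoment) * √10 := by positivity
      linarith
    rw [e1]
    calc 4 * dominationConst / gaussianAbsMoment * κ / ((1 - 2 * p) * √m)
          * (2 * meanWidth K + 10 * β)
        ≤ 4 * dominationConst / gaussianAbsMoment * κ / ((1 - 2 * p) * √m)
          * (10 * (meanWidth K + β)) := by gcongr; linarith
      _ = 40 * dominationConst / gaussianAbsMoment * κ / ((1 - 2 * p) * √m)
          * (meanWidth K + β) := by ring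
      _ ≤ _ := by gcongr
  have hr0 : 0 ≤ r := by positivity
  have hfirst : ∀ ε' : ℝ, 0 ≤ ε' → (4 + 8 / gaussianAbsMoment) * √(10 * κ * √√ε')
      ≤ recoveryConst * √κ * ε' ^ (1 / 8 : ℝ) := fun ε' hε' => by
    rw [sqrt_mul_sqrt_sqrt hκpos.le hε', ← mul_assoc, ← mul_assoc]
    gcongr
    unfold recoveryConst
    have : 0 ≤ 40 * dominationConst / gaussianAbsMoment := by positivity
    linarith
  -- The bias estimate needs δ > 0 while ε may be 0, so the bound is proved for every ε' > ε and
  -- passed to the limit by continuity.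
  have hbound : ∀ ε' : ℝ, ε < ε' → ‖x - x'‖ ^ 2
      ≤ recoveryConst * √κ * ε' ^ (1 / 8 : ℝ)
        + recoveryConst * κ / ((1 - 2 * p) * √m) * (meanWidth K + β) := fun ε' hε' => by
    have hε'0 : 0 < ε' := by linarith
    refine le_trans ?_ (add_le_add (hfirst ε' hε'0.le) hsecond)
    set δ := 10 * κ * √√ε' with hδ
    have hδ0 : 0 < δ := by positivity
    have hr0' : 0 ≤ 2 / gaussianAbsMoment * (r / ((1 - 2 * p) * m)) := by positivity
    rcases le_or_gt δ 1 with hδ1 | hδ1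
    · have hv : ∀ i, inner ℝ (∫ ω', Y i ω' ∂P) (x' - x) ≤ (1 - 2 * p)
          * ((2 * gaussianAbsMoment + 4) * √δ - gaussianAbsMoment / 2 * ‖x - x'‖ ^ 2) := fun i => by
        have hind : IndepFun (e i) (a i) P :=
          (hae.comp (measurable_pi_apply i) (measurable_pi_apply i)).symm
        have hgm : Measurable fun u : EuclideanSpace ℝ (Fin n) =>
            sgn (inner ℝ u x) * inner ℝ u (x' - x) := by
          have : Measurable fun u : EuclideanSpace ℝ (Fin n) => sgn (inner ℝ u x) :=
            measurable_sgn.comp (by fun_prop)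
          fun_prop
        have h1 : inner ℝ (∫ ω', Y i ω' ∂P) (x' - x)
            = ∫ ω', e i ω' * (sgn (inner ℝ (a i ω') x) * inner ℝ (a i ω') (x' - x)) ∂P := by
          rw [real_inner_comm, ← integral_inner (hYi i)]
          refine integral_congr_ae (Filter.Eventually.of_forall fun ω' => ?_)
          simp only [hY, hf]
          rw [real_inner_smul_right, real_inner_comm (x' - x), mul_assoc]
        have h2 := (hind.comp measurable_id hgm).integral_mul_eq_mul_integral
          (he i).aestronglyMeasurable (hgm.comp (ha i)).aestronglyMeasurable
        simp only [Pi.mul_apply, Function.comp_apply, id] at h2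
        rw [h1, h2, integral_flip_eq (he i) (hep i) (hen i)]
        refine mul_le_mul_of_nonneg_left ?_ hq.le
        exact integral_sgn_mul_inner_le (hai i) (ha i) hL.le hδ0 hδ1
          (abs_integral_abs_inner_sub_le ha₀ hsym hsub hvar hε'0 (htv.trans hε'.le) (ha i) (hic i)
            (hμ i)) hx hx'1
      refine (sq_norm_sub_le_of_isSolution hm hK hxK hsol hp hL hrω hv).trans (le_of_eq ?_)
      field_simp
      ring
    -- For δ > 1 the first error term alone exceeds 4, the largest possible squared distance.
    · have h1 : ‖x - x'‖ ≤ 2 := (norm_sub_le _ _).trans (by linarith)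
      have h2 : 1 ≤ √δ := Real.one_le_sqrt.2 hδ1.le
      have h3 : 0 ≤ 8 / gaussianAbsMoment := by positivity
      nlinarith [norm_nonneg (x - x')]
  have hcont : Continuous fun ε' : ℝ => recoveryConst * √κ * ε' ^ (1 / 8 : ℝ)
        + recoveryConst * κ / ((1 - 2 * p) * √m) * (meanWidth K + β) :=
    ((Real.continuous_rpow_const (by norm_num)).const_mul _).add continuous_const
  exact ge_of_tendsto ((hcont.tendsto ε).mono_left (nhdsWithin_le_nhds (s := Set.Ioi ε)))
    (by filter_upwards [self_mem_nhdsWithin] with ε' h using hbound ε' h)
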